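/- The standard complex Gaussian measure on $\mathbb C^n$ is $d\gamma_n(w)=\pi^{-n}e^{-|w|^2}\,d\ell(w)$, where $|w|^2=\sum_j|w_j|^2$ and $\ell$ is Lebesgue measure on $\mathbb C^n\simeq\mathbb R^{2n}$. A random vector $X=(X_1,\dots,X_N)\in\mathbb C^N$ is a centered complex Gaussian vector if $X=AG$ almost surely for some $n\ge 0$, some random vector $G$ in $\mathbb C^n$ with law $\gamma_n$, and some $\mathbb C$-linear map $A:\mathbb C^n\to\mathbb C^N$. Theorem. Let $(X_1,\dots,X_N)$ be a centered complex Gaussian vector and let $\alpha_1,\dots,\alpha_N\ge 0$ be real numbers (with $0^0=1$). Then all the expectations below are finite, and for every integer $0\le k\le N-1$ $$\mathbb E\prod_{j=1}^{N}|X_j|^{\alpha_j}\ \ge\ \Big(\mathbb E\prod_{j=1}^{k}|X_j|^{\alpha_j}\Big)\Big(\mathbb E\prod_{j=k+1}^{N}|X_j|^{\alpha_j}\Big);$$ in particular $$\mathbb E\prod_{j=1}^{N}|X_j|^{\alpha_j}\ \ge\ \prod_{j=1}^{N}\mathbb E|X_j|^{\alpha_j}.$$ Consequently, among centered complex Gaussian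 vectors in $\mathbb C^N$ with prescribed values of $\mathbb E|X_j|^2$, $j\le N$, the expectation $\mathbb E\prod_{j=1}^N|X_j|^{\alpha_j}$ is minimal when the coordinates are independent: if $Y=(Y_1,\dots,Y_N)$ is a centered complex Gaussian vector, possibly on another probability space, with independent coordinates and $\mathbb E|Y_j|^2=\mathbb E|X_j|^2$ for all $j$, then $\mathbb E\prod_{j}|Y_j|^{\alpha_j}\le\mathbb E\prod_{j}|X_j|^{\alpha_j}$; and such a $Y$ exists. -/

import Mathlib

open MeasureTheory ProbabilityTheory

/-- The standard complex Gaussian measure on `ℂⁿ`: density `π⁻ⁿ exp (-|w|²)` with respect to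
Lebesgue measure, where `|w|² = ∑ j, |w j|²`. -/
noncomputable def stdComplexGaussian (n : ℕ) : Measure (Fin n → ℂ) :=
  (volume : Measure (Fin n → ℂ)).withDensity fun w =>
    ENNReal.ofReal ((Real.pi ^ n)⁻¹ * Real.exp (-∑ j, ‖w j‖ ^ 2))

/-- A random vector `X` with values in `ℂᴺ` is a centered complex Gaussian vector if it is
(almost surely) the image `A G` of a standard complex Gaussian vector `G` in some `ℂⁿ` under a
`ℂ`-linear map `A : ℂⁿ → ℂᴺ`. -/
def IsCenteredComplexGaussian {Ω : Type*} [MeasurableSpace Ω] {N : ℕ}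
    (X : Ω → Fin N → ℂ) (P : Measure Ω) : Prop :=
  ∃ (n : ℕ) (G : Ω → Fin n → ℂ) (A : (Fin n → ℂ) →ₗ[ℂ] (Fin N → ℂ)),
    HasLaw G (stdComplexGaussian n) P ∧ ∀ᵐ ω ∂P, X ω = A (G ω)

/-! Correlation is a subharmonic function of the covariance. For standard Gaussian vectors X, Y in
ℂⁿ with E Y X* = c, |c| ≤ 1, put F(c) = E f(X) g(Y) (`gaussCorr`). Then F(0) = E f · E g. On |c| = 1
one has Y = cX, so F(c) = E fg as soon as g is invariant under unit scalars. The maximum principle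
on the disc therefore yields E f · E g ≤ E fg (`SmoothPSH.integral_mul_ge`).

Subharmonicity comes from four-point means. The excess of the mean of F over the points c + t²iᵏ
above F(c) is the expectation of a product of increments of f and g (`integral_rotAvg_mul`). Divided
by t⁴, it tends to E A_X(w)(B_Y(w) - B_Y(w')), where A, B are the complex Hessians of f, g and w, w'
are independent Gaussian vectors, independent of X, Y (`tendsto_gaussCorr_defect`). Both Hessians
are sums of squared moduli of linear forms, and such sums are positively correlated, because
E|ℓ|²|m|² = E|ℓ|² E|m|² + |E ℓ m̄|² (`integral_norm_sq_mul_norm_sq_ge`).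

The products ∏|ℓⱼ|^αⱼ are limits, as ε → 0, of the smooth functions ∏(|ℓⱼ|² + ε)^(αⱼ/2), which are
circular and plurisubharmonic, being exponentials of plurisubharmonic functions
(`smoothPSH_regProd`). For the extremal statement, E|Xⱼ|^α is a function of E|Xⱼ|² alone
(`integral_norm_rpow_linear_eq`), so the product of the individual moments is exactly the moment of
the independent vector. -/

set_option synthInstance.maxSize 1000

/-! ### Complex Gaussian measures: moments, characteristic functions, product structure -/

/-- The standard complex Gaussian measure on `ℂ`. -/
noncomputable def complexGaussian : Measure ℂ :=
  (volume : Measure ℂ).withDensity fun z => ENNReal.ofReal (Real.pi⁻¹ * Real.exp (-‖z‖ ^ 2))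

lemma integral_complexGaussian {F : Type*} [NormedAddCommGroup F] [NormedSpace ℝ F] (g : ℂ → F) :
    ∫ z, g z ∂complexGaussian = ∫ z, (Real.pi⁻¹ * Real.exp (-‖z‖ ^ 2)) • g z := by
  rw [complexGaussian, integral_withDensity_eq_integral_toReal_smul (by fun_prop) (by simp)]
  refine integral_congr_ae (Filter.Eventually.of_forall fun z => ?_)
  simp only
  rw [ENNReal.toReal_ofReal (by positivity)]

lemma integral_norm_rpow_complexGaussian {q : ℝ} (hq : 0 ≤ q) :
    ∫ z, ‖z‖ ^ q ∂complexGaussian = Real.Gamma ((q + 2) / 2) := by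
  rw [integral_complexGaussian]
  have h := Complex.integral_rpow_mul_exp_neg_rpow (p := 2) (q := q) (by norm_num) (by linarith)
  have : ∀ z : ℂ, (Real.pi⁻¹ * Real.exp (-‖z‖ ^ 2)) • ‖z‖ ^ q
      = Real.pi⁻¹ * (‖z‖ ^ q * Real.exp (-‖z‖ ^ (2 : ℝ))) := by
    intro z; rw [Real.rpow_two, smul_eq_mul]; ring
  simp_rw [this]
  rw [integral_const_mul, h]
  field_simp

lemma integrable_norm_rpow_complexGaussian {q : ℝ} (hq : 0 ≤ q) :
    Integrable (fun z => ‖z‖ ^ q) complexGaussian := by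
  -- The integral of a non-integrable function is 0 by convention, so the positive Gamma value
  -- already gives integrability.
  apply Integrable.of_integral_ne_zero
  rw [integral_norm_rpow_complexGaussian hq]
  exact (Real.Gamma_pos_of_pos (by positivity)).ne'

instance isProbabilityMeasure_complexGaussian : IsProbabilityMeasure complexGaussian := by
  have h := integral_norm_rpow_complexGaussian le_rfl
  simp only [Real.rpow_zero, zero_add, div_self (two_ne_zero (α := ℝ)), Real.Gamma_one,
    integral_const, smul_eq_mul, mul_one] at h
  refine ⟨?_⟩
  rw [measureReal_def] at h
  rw [← ENNReal.ofReal_toReal (a := complexGaussian Set.univ), h, ENNReal.ofReal_one]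
  intro h'
  simp [h'] at h

lemma integral_norm_sq_complexGaussian : ∫ z, ‖z‖ ^ 2 ∂complexGaussian = 1 := by
  have h := integral_norm_rpow_complexGaussian (q := 2) (by norm_num)
  simp only [Real.rpow_two] at h
  rw [h]
  norm_num

/-- Every real functional on ℂ is the inner product with w = L(1) + i L(i), which leaves a Gaussian
Fourier integral. The factor 1/4 reflects variance 1/2 for each of the real and imaginary parts. -/
lemma charFunDual_complexGaussian (L : StrongDual ℝ ℂ) :
    charFunDual complexGaussian L
      = Complex.exp (-((L 1) ^ 2 + (L Complex.I) ^ 2 : ℝ) / 4) := by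
  rw [charFunDual_apply, integral_complexGaussian]
  set w : ℂ := ⟨L 1, L Complex.I⟩ with hw
  have hL : ∀ z : ℂ, L z = inner ℝ w z := by
    intro z
    have : z = z.re • (1 : ℂ) + z.im • Complex.I := by
      simp [Complex.re_add_im]
    conv_lhs => rw [this]
    rw [map_add, map_smul, map_smul, Complex.inner, hw]
    simp
  have h := GaussianFourier.integral_cexp_neg_mul_sq_norm_add (V := ℂ) (b := 1) (by simp)
    Complex.I w
  have h2 : ∀ z : ℂ, (Real.pi⁻¹ * Real.exp (-‖z‖ ^ 2)) • Complex.exp (L z * Complex.I)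
      = (Real.pi : ℂ)⁻¹ * Complex.exp (-1 * (‖z‖ : ℂ) ^ 2 + Complex.I * (inner ℝ w z : ℝ)) := by
    intro z
    rw [Complex.real_smul, hL, Complex.exp_add]
    push_cast
    ring_nf
  simp_rw [h2]
  rw [integral_const_mul, h]
  have hpi : (Real.pi : ℂ) ≠ 0 := by exact_mod_cast Real.pi_ne_zero
  have hn : (‖w‖ : ℂ) ^ 2 = ((L 1) ^ 2 + (L Complex.I) ^ 2 : ℝ) := by
    rw [← Complex.ofReal_pow, Complex.sq_norm, Complex.normSq_apply, hw, sq, sq]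
  rw [hn, Complex.finrank_real_complex]
  simp [hpi]

lemma charFunDual_pi_complexGaussian {ι : Type*} [Fintype ι] [DecidableEq ι]
    (L : StrongDual ℝ (ι → ℂ)) :
    charFunDual (Measure.pi fun _ : ι => complexGaussian) L
      = Complex.exp (-(∑ j, ((L (Pi.single j 1)) ^ 2 + (L (Pi.single j Complex.I)) ^ 2) : ℝ) / 4) := by
  rw [charFunDual_pi]
  simp_rw [charFunDual_complexGaussian]
  rw [← Complex.exp_sum]
  simp [← Finset.sum_div, ← Finset.sum_neg_distrib]

/-- The density and the character both factor over the coordinates, so the characteristic functions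
agree. Finiteness of the measure is established beforehand because uniqueness from characteristic
functions requires it. -/
lemma stdComplexGaussian_eq_pi (n : ℕ) :
    stdComplexGaussian n = Measure.pi fun _ : Fin n => complexGaussian := by
  have hd : ∀ w : Fin n → ℂ, (Real.pi ^ n)⁻¹ * Real.exp (-∑ j, ‖w j‖ ^ 2)
      = ∏ j, (Real.pi⁻¹ * Real.exp (-‖w j‖ ^ 2)) := by
    intro w
    rw [Finset.prod_mul_distrib, ← Real.exp_sum]
    simp
  have hint : Integrable (fun z : ℂ => Real.pi⁻¹ * Real.exp (-‖z‖ ^ 2)) := by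
    have : ∫ z : ℂ, Real.pi⁻¹ * Real.exp (-‖z‖ ^ 2) = 1 := by
      have := integral_complexGaussian (fun _ => (1 : ℝ))
      simpa using this.symm
    exact Integrable.of_integral_ne_zero (by rw [this]; exact one_ne_zero)
  have hfin : IsFiniteMeasure (stdComplexGaussian n) := by
    apply isFiniteMeasure_withDensity_ofReal
    simp_rw [hd]
    exact (Integrable.fintype_prod fun _ => hint).2
  refine Measure.ext_of_charFunDual (funext fun L => ?_)
  rw [charFunDual_pi, charFunDual_apply, stdComplexGaussian,
    integral_withDensity_eq_integral_toReal_smul (by fun_prop) (by simp)]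
  simp_rw [charFunDual_apply, integral_complexGaussian]
  rw [volume_pi, ← integral_fintype_prod_eq_prod]
  refine integral_congr_ae (Filter.Eventually.of_forall fun w => ?_)
  simp only
  rw [ENNReal.toReal_ofReal (by positivity), hd, ← L.sum_comp_single]
  simp only [Complex.real_smul, Complex.ofReal_sum,
    Finset.sum_mul, Complex.exp_sum, Finset.prod_mul_distrib]
  push_cast
  rw [Finset.prod_mul_distrib]

instance isProbabilityMeasure_stdComplexGaussian (n : ℕ) :
    IsProbabilityMeasure (stdComplexGaussian n) := by
  rw [stdComplexGaussian_eq_pi]; infer_instance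

lemma charFunDual_stdComplexGaussian {n : ℕ} (L : StrongDual ℝ (Fin n → ℂ)) :
    charFunDual (stdComplexGaussian n) L
      = Complex.exp (-(∑ j, ((L (Pi.single j 1)) ^ 2 + (L (Pi.single j Complex.I)) ^ 2) : ℝ) / 4) := by
  rw [stdComplexGaussian_eq_pi, charFunDual_pi_complexGaussian]

lemma integrable_norm_coord_pow (n : ℕ) (j : Fin n) (K : ℕ) :
    Integrable (fun w : Fin n → ℂ => ‖w j‖ ^ K) (stdComplexGaussian n) := by
  rw [stdComplexGaussian_eq_pi]
  have := integrable_norm_rpow_complexGaussian (q := K) (by positivity)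
  simp_rw [Real.rpow_natCast] at this
  exact integrable_comp_eval (μ := fun _ : Fin n => complexGaussian) (i := j) this

lemma integrable_norm_pow_stdComplexGaussian (n K : ℕ) :
    Integrable (fun w : Fin n → ℂ => ‖w‖ ^ K) (stdComplexGaussian n) := by
  -- The sup norm is attained at some coordinate; the summand 1 covers n = 0, where the sum is empty
  -- but 0 ^ 0 = 1.
  have hb : Integrable (fun w : Fin n → ℂ => 1 + ∑ j, ‖w j‖ ^ K) (stdComplexGaussian n) :=
    (integrable_const _).add (integrable_finsetSum _ fun j _ => integrable_norm_coord_pow n j K)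
  refine hb.mono' (by fun_prop) (Filter.Eventually.of_forall fun w => ?_)
  rw [Real.norm_of_nonneg (by positivity)]
  have hs : 0 ≤ ∑ j, ‖w j‖ ^ K := by positivity
  rcases isEmpty_or_nonempty (Fin n) with h | h
  · have : w = 0 := Subsingleton.elim _ _
    rw [this, norm_zero]
    have : (0:ℝ) ^ K ≤ 1 := pow_le_one₀ le_rfl zero_le_one
    simp only [Finset.univ_eq_empty, Finset.sum_empty, add_zero]
    exact this
  · obtain ⟨j, -, hj⟩ := Finset.exists_mem_eq_sup' (Finset.univ_nonempty) (fun j => ‖w j‖₊)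
    have : ‖w‖ = ‖w j‖ := by
      rw [Pi.norm_def, ← Finset.sup'_eq_sup Finset.univ_nonempty, hj]; rfl
    rw [this]
    have := Finset.single_le_sum (f := fun j => ‖w j‖ ^ K) (fun i _ => by positivity)
      (Finset.mem_univ j)
    linarith

/-! ### Linear combinations of four independent Gaussian vectors -/

/-- Quadruples of vectors of `ℂⁿ`. -/
abbrev Quad (n : ℕ) : Type := ((Fin n → ℂ) × (Fin n → ℂ)) × ((Fin n → ℂ) × (Fin n → ℂ))

/-- Four independent standard complex Gaussian vectors. -/
noncomputable def quadGaussian (n : ℕ) :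
    Measure (Quad n) :=
  ((stdComplexGaussian n).prod (stdComplexGaussian n)).prod
    ((stdComplexGaussian n).prod (stdComplexGaussian n))

instance isProbabilityMeasure_quadGaussian (n : ℕ) :
    IsProbabilityMeasure (quadGaussian n) := by
  rw [quadGaussian]; infer_instance

/-- The linear combination of four vectors with complex coefficients `a`. -/
def lincomb {n : ℕ} (a : Fin 4 → ℂ)
    (z : Quad n) : Fin n → ℂ :=
  a 0 • z.1.1 + a 1 • z.1.2 + a 2 • z.2.1 + a 3 • z.2.2

/-- `lincomb a` as a continuous linear map. -/
noncomputable def lincombL {n : ℕ} (a : Fin 4 → ℂ) :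
    Quad n →L[ℝ] (Fin n → ℂ) where
  toFun := lincomb a
  map_add' x y := by simp only [lincomb, Prod.fst_add, Prod.snd_add, smul_add]; abel
  map_smul' r x := by
    simp only [lincomb, Prod.smul_fst, Prod.smul_snd, smul_add, RingHom.id_apply,
      smul_comm r]
  cont := by unfold lincomb; fun_prop

/-- This is the contribution of one coordinate of a Gaussian vector G to the exponent of the
characteristic function of (cG, dG). Only |c|², |d|² and c d̄ survive: adding the directions 1 and i
cancels the terms in c², d² and cd, which is the circularity of G. -/
lemma dual_pair_sq_add_sq {n : ℕ} (L : StrongDual ℝ ((Fin n → ℂ) × (Fin n → ℂ))) (j : Fin n)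
    (c d : ℂ) :
    L (c • Pi.single j 1, d • Pi.single j 1) ^ 2
        + L (c • Pi.single j Complex.I, d • Pi.single j Complex.I) ^ 2 =
      ‖c‖ ^ 2 * (L (Pi.single j 1, 0) ^ 2 + L (Pi.single j Complex.I, 0) ^ 2)
      + ‖d‖ ^ 2 * (L (0, Pi.single j 1) ^ 2 + L (0, Pi.single j Complex.I) ^ 2)
      + 2 * ((c * (starRingEnd ℂ) d).re * (L (Pi.single j 1, 0) * L (0, Pi.single j 1)
          + L (Pi.single j Complex.I, 0) * L (0, Pi.single j Complex.I))
        - (c * (starRingEnd ℂ) d).im * (L (Pi.single j 1, 0) * L (0, Pi.single j Complex.I)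
          - L (Pi.single j Complex.I, 0) * L (0, Pi.single j 1))) := by
  have e1 : ((c • Pi.single j 1, d • Pi.single j 1) : (Fin n → ℂ) × (Fin n → ℂ))
      = c.re • (Pi.single j 1, 0) + c.im • (Pi.single j Complex.I, 0)
        + d.re • (0, Pi.single j 1) + d.im • (0, Pi.single j Complex.I) := by
    ext i <;> by_cases h : i = j <;> simp [h, Complex.re_add_im]
  have e2 : ((c • Pi.single j Complex.I, d • Pi.single j Complex.I) :
      (Fin n → ℂ) × (Fin n → ℂ))
      = (-c.im) • (Pi.single j 1, 0) + c.re • (Pi.single j Complex.I, 0)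
        + (-d.im) • (0, Pi.single j 1) + d.re • (0, Pi.single j Complex.I) := by
    ext i <;> by_cases h : i = j <;> simp [h, Complex.ext_iff]
  rw [e1, e2]
  simp only [map_add, map_smul, smul_eq_mul, Complex.sq_norm, Complex.normSq_apply,
    Complex.mul_re, Complex.mul_im, Complex.conj_re, Complex.conj_im]
  ring

lemma lincombL_apply {n : ℕ} (a : Fin 4 → ℂ)
    (z : Quad n) :
    lincombL a z = a 0 • z.1.1 + a 1 • z.1.2 + a 2 • z.2.1 + a 3 • z.2.2 := rfl

lemma charFunDual_quadGaussian_map {n : ℕ} (a b : Fin 4 → ℂ)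
    (L : StrongDual ℝ ((Fin n → ℂ) × (Fin n → ℂ))) :
    charFunDual ((quadGaussian n).map fun z => (lincomb a z, lincomb b z)) L =
      Complex.exp (-((∑ j,
        ((∑ i, ‖a i‖ ^ 2) * (L (Pi.single j 1, 0) ^ 2 + L (Pi.single j Complex.I, 0) ^ 2)
      + (∑ i, ‖b i‖ ^ 2) * (L (0, Pi.single j 1) ^ 2 + L (0, Pi.single j Complex.I) ^ 2)
      + 2 * ((∑ i, a i * (starRingEnd ℂ) (b i)).re * (L (Pi.single j 1, 0) * L (0, Pi.single j 1)
          + L (Pi.single j Complex.I, 0) * L (0, Pi.single j Complex.I))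
        - (∑ i, a i * (starRingEnd ℂ) (b i)).im *
          (L (Pi.single j 1, 0) * L (0, Pi.single j Complex.I)
          - L (Pi.single j Complex.I, 0) * L (0, Pi.single j 1)))) : ℝ) : ℂ) / 4) := by
  have hT : (fun z => (lincomb a z, lincomb b z)) =
      ⇑((lincombL (n := n) a).prod (lincombL b)) := rfl
  rw [hT, charFunDual_map, quadGaussian, charFunDual_prod, charFunDual_prod, charFunDual_prod]
  simp_rw [charFunDual_stdComplexGaussian]
  rw [← Complex.exp_add, ← Complex.exp_add, ← Complex.exp_add]
  congr 1
  rw [← add_div, ← add_div, ← add_div]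
  congr 1
  rw [← neg_add, ← neg_add, ← neg_add]
  congr 1
  norm_cast
  rw [← Finset.sum_add_distrib, ← Finset.sum_add_distrib, ← Finset.sum_add_distrib]
  refine Finset.sum_congr rfl fun j _ => ?_
  simp only [ContinuousLinearMap.comp_apply, ContinuousLinearMap.prod_apply,
    ContinuousLinearMap.inl_apply, ContinuousLinearMap.inr_apply]
  simp only [lincombL_apply,
    Prod.fst_zero, Prod.snd_zero, smul_zero, add_zero, zero_add, dual_pair_sq_add_sq, Fin.sum_univ_four,
    Complex.add_re, Complex.add_im]
  ring

/-- The joint law of two linear combinations of independent standard complex Gaussian vectors is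
determined by the Gram matrix of the coefficients. -/
lemma quadGaussian_map_eq {n : ℕ} {a b a' b' : Fin 4 → ℂ}
    (ha : ∑ i, ‖a i‖ ^ 2 = ∑ i, ‖a' i‖ ^ 2) (hb : ∑ i, ‖b i‖ ^ 2 = ∑ i, ‖b' i‖ ^ 2)
    (hab : ∑ i, a i * (starRingEnd ℂ) (b i) = ∑ i, a' i * (starRingEnd ℂ) (b' i)) :
    (quadGaussian n).map (fun z => (lincomb a z, lincomb b z)) =
      (quadGaussian n).map (fun z => (lincomb a' z, lincomb b' z)) := by
  have hm : ∀ a b : Fin 4 → ℂ, Measurable fun z :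
      Quad n => (lincomb a z, lincomb b z) :=
    fun a b => ((lincombL a).prod (lincombL b)).continuous.measurable
  have := Measure.isProbabilityMeasure_map (μ := quadGaussian n) (hm a b).aemeasurable
  have := Measure.isProbabilityMeasure_map (μ := quadGaussian n) (hm a' b').aemeasurable
  refine Measure.ext_of_charFunDual (funext fun L => ?_)
  rw [charFunDual_quadGaussian_map, charFunDual_quadGaussian_map, ha, hb, hab]

@[fun_prop]
lemma continuous_lincomb {n : ℕ} (a : Fin 4 → ℂ) : Continuous (lincomb (n := n) a) :=
  (lincombL a).continuous

lemma integral_lincomb_eq {n : ℕ} {a b a' b' : Fin 4 → ℂ}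
    (ha : ∑ i, ‖a i‖ ^ 2 = ∑ i, ‖a' i‖ ^ 2) (hb : ∑ i, ‖b i‖ ^ 2 = ∑ i, ‖b' i‖ ^ 2)
    (hab : ∑ i, a i * (starRingEnd ℂ) (b i) = ∑ i, a' i * (starRingEnd ℂ) (b' i))
    {F : (Fin n → ℂ) → (Fin n → ℂ) → ℝ} (hF : Continuous fun p : (Fin n → ℂ) × (Fin n → ℂ) => F p.1 p.2) :
    ∫ z, F (lincomb a z) (lincomb b z) ∂(quadGaussian n) =
      ∫ z, F (lincomb a' z) (lincomb b' z) ∂(quadGaussian n) := by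
  have h := congrArg (fun ν => ∫ p, F p.1 p.2 ∂ν) (quadGaussian_map_eq (n := n) ha hb hab)
  rwa [integral_map (by fun_prop) hF.aestronglyMeasurable,
    integral_map (by fun_prop) hF.aestronglyMeasurable] at h

lemma integrable_norm_pow_quadGaussian (n K : ℕ) :
    Integrable (fun z => (1 + ‖z‖) ^ K) (quadGaussian n) := by
  have h1 : ∀ {E F : Type} [NormedAddCommGroup E] [NormedAddCommGroup F] [MeasurableSpace E]
      [MeasurableSpace F] [OpensMeasurableSpace (E × F)] (μ : Measure E) (ν : Measure F) [IsProbabilityMeasure μ]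
      [IsProbabilityMeasure ν], Integrable (fun x => ‖x‖ ^ K) μ → Integrable (fun x => ‖x‖ ^ K) ν →
      Integrable (fun x => ‖x‖ ^ K) (μ.prod ν) := by
    intro E F _ _ _ _ _ μ ν _ _ h h'
    refine ((h.comp_fst ν).add (h'.comp_snd μ)).mono' ?_ (Filter.Eventually.of_forall fun x => ?_)
    · exact (continuous_norm.pow K).measurable.aestronglyMeasurable
    · rw [Real.norm_of_nonneg (by positivity), Prod.norm_def]
      simp only [Pi.add_apply]
      have := pow_nonneg (norm_nonneg x.1) K
      have := pow_nonneg (norm_nonneg x.2) K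
      rcases max_cases ‖x.1‖ ‖x.2‖ with h | h <;> rw [h.1] <;> linarith
  have hγ := integrable_norm_pow_stdComplexGaussian n K
  have h4 : Integrable (fun z => ‖z‖ ^ K) (quadGaussian n) :=
    h1 _ _ (h1 _ _ hγ hγ) (h1 _ _ hγ hγ)
  refine (((integrable_const (1 : ℝ)).add h4).const_mul (2 ^ (K - 1))).mono'
    (by fun_prop) (Filter.Eventually.of_forall fun z => ?_)
  rw [Real.norm_of_nonneg (by positivity)]
  have := add_pow_le (zero_le_one (α := ℝ)) (norm_nonneg z) K
  simpa using this

/-! ### Polynomial growth and integrability -/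

/-- Functions of at most polynomial growth. -/
def PolyBdd {V : Type*} [SeminormedAddCommGroup V] (f : V → ℝ) : Prop :=
  ∃ (C : ℝ) (K : ℕ), 0 ≤ C ∧ ∀ x, |f x| ≤ C * (1 + ‖x‖) ^ K

namespace PolyBdd

variable {V U : Type*} [SeminormedAddCommGroup V] [SeminormedAddCommGroup U] {f g : V → ℝ}

lemma mono (hg : PolyBdd g) (h : ∀ x, |f x| ≤ |g x|) : PolyBdd f := by
  obtain ⟨C, K, hC, hb⟩ := hg
  exact ⟨C, K, hC, fun x => (h x).trans (hb x)⟩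

lemma const (c : ℝ) : PolyBdd (fun _ : V => c) := ⟨|c|, 0, abs_nonneg c, fun x => by simp⟩

lemma mul (hf : PolyBdd f) (hg : PolyBdd g) : PolyBdd (fun x => f x * g x) := by
  obtain ⟨C, K, hC, hb⟩ := hf
  obtain ⟨D, M, hD, hb'⟩ := hg
  refine ⟨C * D, K + M, mul_nonneg hC hD, fun x => ?_⟩
  rw [abs_mul, pow_add]
  calc |f x| * |g x| ≤ (C * (1 + ‖x‖) ^ K) * (D * (1 + ‖x‖) ^ M) :=
        mul_le_mul (hb x) (hb' x) (abs_nonneg _) (by positivity)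
    _ = _ := by ring

lemma add (hf : PolyBdd f) (hg : PolyBdd g) : PolyBdd (fun x => f x + g x) := by
  obtain ⟨C, K, hC, hb⟩ := hf
  obtain ⟨D, M, hD, hb'⟩ := hg
  refine ⟨C + D, K + M, add_nonneg hC hD, fun x => ?_⟩
  have h1 : (1 : ℝ) ≤ 1 + ‖x‖ := by simp
  have hK : (1 + ‖x‖) ^ K ≤ (1 + ‖x‖) ^ (K + M) := pow_le_pow_right₀ h1 (by omega)
  have hM : (1 + ‖x‖) ^ M ≤ (1 + ‖x‖) ^ (K + M) := pow_le_pow_right₀ h1 (by omega)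
  calc |f x + g x| ≤ |f x| + |g x| := abs_add_le _ _
    _ ≤ C * (1 + ‖x‖) ^ K + D * (1 + ‖x‖) ^ M := add_le_add (hb x) (hb' x)
    _ ≤ C * (1 + ‖x‖) ^ (K + M) + D * (1 + ‖x‖) ^ (K + M) := by gcongr
    _ = _ := by ring

lemma const_mul (c : ℝ) (hf : PolyBdd f) : PolyBdd (fun x => c * f x) := (const c).mul hf

lemma neg (hf : PolyBdd f) : PolyBdd (fun x => -f x) := hf.mono fun x => by simp

lemma sub (hf : PolyBdd f) (hg : PolyBdd g) : PolyBdd (fun x => f x - g x) := by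
  simpa [sub_eq_add_neg] using hf.add hg.neg

lemma sum {ι : Type*} (s : Finset ι) {F : ι → V → ℝ} (h : ∀ i ∈ s, PolyBdd (F i)) :
    PolyBdd (fun x => ∑ i ∈ s, F i x) := by
  classical
  induction s using Finset.induction_on with
  | empty => simpa using const 0
  | insert a s ha ih =>
    simp_rw [Finset.sum_insert ha]
    exact (h a (by simp)).add (ih fun i hi => h i (by simp [hi]))

lemma prod {ι : Type*} (s : Finset ι) {F : ι → V → ℝ} (h : ∀ i ∈ s, PolyBdd (F i)) :
    PolyBdd (fun x => ∏ i ∈ s, F i x) := by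
  classical
  induction s using Finset.induction_on with
  | empty => simpa using const 1
  | insert a s ha ih =>
    simp_rw [Finset.prod_insert ha]
    exact (h a (by simp)).mul (ih fun i hi => h i (by simp [hi]))

lemma pow (hf : PolyBdd f) (k : ℕ) : PolyBdd (fun x => f x ^ k) := by
  simpa using prod (Finset.range k) (F := fun _ => f) fun _ _ => hf

lemma norm_of_le {W : Type*} [SeminormedAddCommGroup W] {T : V → W} {C : ℝ} (hC : 0 ≤ C)
    (h : ∀ x, ‖T x‖ ≤ C * ‖x‖) : PolyBdd (fun x => ‖T x‖) :=
  ⟨C, 1, hC, fun x => by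
    rw [abs_norm, pow_one]
    exact (h x).trans (by nlinarith [norm_nonneg x])⟩

lemma norm_clm {W : Type*} [SeminormedAddCommGroup W] [NormedSpace ℝ V] [NormedSpace ℝ W]
    (T : V →L[ℝ] W) : PolyBdd (fun x => ‖T x‖) :=
  norm_of_le (norm_nonneg T) T.le_opNorm

lemma comp (hf : PolyBdd f) {T : U → V} (hT : PolyBdd (fun x => ‖T x‖)) :
    PolyBdd (fun x => f (T x)) := by
  obtain ⟨C, K, hC, hb⟩ := hf
  obtain ⟨D, M, hD, h⟩ := (((const 1).add hT).pow K).const_mul C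
  refine ⟨D, M, hD, fun x => (hb (T x)).trans ((le_abs_self _).trans (h x))⟩

lemma rpow (hf : PolyBdd f) (h0 : ∀ x, 0 ≤ f x) {s : ℝ} (hs : 0 ≤ s) :
    PolyBdd (fun x => f x ^ s) := by
  obtain ⟨k, hk⟩ := exists_nat_ge s
  refine (((const 1).add hf).pow k).mono fun x => ?_
  have h1 := h0 x
  rw [abs_of_nonneg (by positivity), abs_of_nonneg (by positivity)]
  calc f x ^ s ≤ (1 + f x) ^ s := Real.rpow_le_rpow h1 (by linarith) hs
    _ ≤ (1 + f x) ^ (k : ℝ) := Real.rpow_le_rpow_of_exponent_le (by linarith) hk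
    _ = _ := Real.rpow_natCast _ _

lemma integrable_quadGaussian {n : ℕ}
    {F : Quad n → ℝ}
    (h : PolyBdd F) (hc : Continuous F) : Integrable F (quadGaussian n) := by
  obtain ⟨C, K, hC, hb⟩ := h
  exact ((integrable_norm_pow_quadGaussian n K).const_mul C).mono'
    hc.measurable.aestronglyMeasurable (Filter.Eventually.of_forall hb)

end PolyBdd

lemma measurePreserving_quadGaussian (n : ℕ) :
    MeasurePreserving (fun z : Quad n => z.1.1) (quadGaussian n) (stdComplexGaussian n) :=
  measurePreserving_fst.comp measurePreserving_fst

lemma integral_quadGaussian_fst {n : ℕ} {h : (Fin n → ℂ) → ℝ} (hc : Continuous h) :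
    ∫ z, h z.1.1 ∂(quadGaussian n) = ∫ x, h x ∂(stdComplexGaussian n) := by
  rw [← (measurePreserving_quadGaussian n).map_eq,
    integral_map (by fun_prop) hc.aestronglyMeasurable]

lemma PolyBdd.integrable_stdComplexGaussian {n : ℕ} {F : (Fin n → ℂ) → ℝ}
    (h : PolyBdd F) (hc : Continuous F) : Integrable F (stdComplexGaussian n) := by
  rw [← (measurePreserving_quadGaussian n).map_eq,
    integrable_map_measure hc.aestronglyMeasurable (by fun_prop)]
  refine PolyBdd.integrable_quadGaussian (h.comp (T := fun z : Quad n => z.1.1)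
    (PolyBdd.norm_of_le zero_le_one fun z => ?_)) (by fun_prop)
  rw [one_mul]
  exact (norm_fst_le z.1).trans (norm_fst_le z)

lemma integral_quadGaussian_mul {n : ℕ} {𝕜 : Type*} [RCLike 𝕜] (h k : (Fin n → ℂ) → 𝕜) :
    ∫ z, h z.1.1 * k z.1.2 ∂(quadGaussian n) =
      (∫ x, h x ∂(stdComplexGaussian n)) * ∫ x, k x ∂(stdComplexGaussian n) := by
  rw [quadGaussian, integral_fun_fst (f := fun p : (Fin n → ℂ) × (Fin n → ℂ) => h p.1 * k p.2),
    integral_prod_mul]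
  simp

/-! ### Positive correlation of squared moduli of linear forms -/

/-- Each factor is a constant plus or minus twice the real part of i⁻ᵏ times a cross term. Summing
over k kills what is linear in these real parts, and the product of the two contributes by ∑
Re(i⁻ᵏa) Re(i⁻ᵏb) = 2 Re(a b̄). -/
lemma sum_rotations_norm_sq_mul (p q s t : ℂ) :
    ∑ k : Fin 4, ‖p + Complex.I ^ (k : ℕ) * q‖ ^ 2 * ‖s - Complex.I ^ (k : ℕ) * t‖ ^ 2 =
      4 * (‖p‖ ^ 2 + ‖q‖ ^ 2) * (‖s‖ ^ 2 + ‖t‖ ^ 2)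
        - 8 * ((p * (starRingEnd ℂ) s) * (starRingEnd ℂ) (q * (starRingEnd ℂ) t)).re := by
  simp only [Fin.sum_univ_four, Complex.sq_norm, Complex.normSq_apply]
  simp [pow_succ]
  ring

lemma polyBdd_norm_linear {n : ℕ} (ℓ : (Fin n → ℂ) →ₗ[ℂ] ℂ) : PolyBdd (fun x => ‖ℓ x‖) :=
  PolyBdd.norm_clm ((LinearMap.toContinuousLinearMap ℓ).restrictScalars ℝ)

lemma continuous_linear {n : ℕ} (ℓ : (Fin n → ℂ) →ₗ[ℂ] ℂ) : Continuous ℓ :=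
  (LinearMap.toContinuousLinearMap ℓ).continuous

lemma polyBdd_coord {n : ℕ} : PolyBdd (fun z : Quad n => ‖z.1.1‖) ∧
   PolyBdd (fun z : Quad n => ‖z.1.2‖) ∧
   PolyBdd (fun z : Quad n => ‖z.2.1‖) ∧
   PolyBdd (fun z : Quad n => ‖z.2.2‖) := by
  refine ⟨?_, ?_, ?_, ?_⟩ <;> refine PolyBdd.norm_of_le zero_le_one fun z => ?_ <;> rw [one_mul]
  · exact (norm_fst_le z.1).trans (norm_fst_le z)
  · exact (norm_snd_le z.1).trans (norm_fst_le z)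
  · exact (norm_fst_le z.2).trans (norm_snd_le z)
  · exact (norm_snd_le z.2).trans (norm_snd_le z)

/-- For independent x, y the vectors x + iᵏy and x - iᵏy are again independent, so each rotated
expectation is 4AB. Summing over k gives 16AB = 8M + 8AB - 8|E ℓ m̄|², that is, M = AB + |E ℓ m̄|².
-/
lemma integral_norm_sq_mul_norm_sq_ge {n : ℕ} (ℓ m : (Fin n → ℂ) →ₗ[ℂ] ℂ) :
    (∫ x, ‖ℓ x‖ ^ 2 ∂(stdComplexGaussian n)) * (∫ x, ‖m x‖ ^ 2 ∂(stdComplexGaussian n)) ≤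
      ∫ x, ‖ℓ x‖ ^ 2 * ‖m x‖ ^ 2 ∂(stdComplexGaussian n) := by
  have cℓ := continuous_linear ℓ
  have cm := continuous_linear m
  set A := ∫ x, ‖ℓ x‖ ^ 2 ∂(stdComplexGaussian n) with hA
  set B := ∫ x, ‖m x‖ ^ 2 ∂(stdComplexGaussian n) with hB
  set M := ∫ x, ‖ℓ x‖ ^ 2 * ‖m x‖ ^ 2 ∂(stdComplexGaussian n) with hM
  have hF : Continuous fun p : (Fin n → ℂ) × (Fin n → ℂ) => ‖ℓ p.1‖ ^ 2 * ‖m p.2‖ ^ 2 := by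
    fun_prop
  have hk : ∀ k : Fin 4, ∫ z, ‖ℓ z.1.1 + Complex.I ^ (k : ℕ) * ℓ z.1.2‖ ^ 2
      * ‖m z.1.1 - Complex.I ^ (k : ℕ) * m z.1.2‖ ^ 2 ∂(quadGaussian n) = 4 * (A * B) := by
    intro k
    -- The two coefficient rows are orthogonal with squared length 2, so they may be replaced by √2
    -- times two basis vectors.
    have h := integral_lincomb_eq (n := n) (a := ![1, Complex.I ^ (k : ℕ), 0, 0])
      (b := ![1, - Complex.I ^ (k : ℕ), 0, 0]) (a' := ![(√2 : ℝ), 0, 0, 0])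
      (b' := ![0, (√2 : ℝ), 0, 0]) (by simp [Fin.sum_univ_four]; norm_num)
      (by simp [Fin.sum_univ_four]; norm_num) (by
        simp [Fin.sum_univ_four, ← mul_pow])
      (F := fun x y => ‖ℓ x‖ ^ 2 * ‖m y‖ ^ 2) hF
    simp only [lincomb, Matrix.cons_val, zero_smul, add_zero, zero_add, one_smul, map_add,
      map_smul, smul_eq_mul, norm_mul, Complex.norm_real, mul_pow, neg_mul] at h
    simp only [← sub_eq_add_neg, Real.norm_eq_abs, sq_abs, Real.sq_sqrt (zero_le_two (α := ℝ))] at h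
    rw [h, hA, hB, ← integral_quadGaussian_mul, ← integral_const_mul]
    congr 1; ext z; ring
  have i1 : ∀ {F : Quad n → ℝ},
      PolyBdd F → Continuous F → Integrable F (quadGaussian n) :=
    fun h hc => h.integrable_quadGaussian hc
  obtain ⟨b1, b2, -, -⟩ := polyBdd_coord (n := n)
  have pl1 := (polyBdd_norm_linear ℓ).comp b1
  have pl2 := (polyBdd_norm_linear ℓ).comp b2
  have pm1 := (polyBdd_norm_linear m).comp b1
  have pm2 := (polyBdd_norm_linear m).comp b2
  have hsum : ∫ z, ∑ k : Fin 4, ‖ℓ z.1.1 + Complex.I ^ (k : ℕ) * ℓ z.1.2‖ ^ 2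
      * ‖m z.1.1 - Complex.I ^ (k : ℕ) * m z.1.2‖ ^ 2 ∂(quadGaussian n) = 16 * (A * B) := by
    rw [integral_finsetSum]
    · simp_rw [hk]; simp; ring
    · intro k _
      refine i1 (PolyBdd.mul (PolyBdd.pow ?_ 2) (PolyBdd.pow ?_ 2)) (by fun_prop)
      · refine (pl1.add pl2).mono fun z => ?_
        rw [abs_of_nonneg (norm_nonneg _), abs_of_nonneg (by positivity)]
        exact (norm_add_le _ _).trans (by simp)
      · refine (pm1.add pm2).mono fun z => ?_
        rw [abs_of_nonneg (norm_nonneg _), abs_of_nonneg (by positivity)]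
        exact (norm_sub_le _ _).trans (by simp)
  simp_rw [sum_rotations_norm_sq_mul] at hsum
  have hcross : ∫ z, ((ℓ z.1.1 * (starRingEnd ℂ) (m z.1.1)) *
      (starRingEnd ℂ) (ℓ z.1.2 * (starRingEnd ℂ) (m z.1.2))).re ∂(quadGaussian n) =
      Complex.normSq (∫ x, ℓ x * (starRingEnd ℂ) (m x) ∂(stdComplexGaussian n)) := by
    have h2 := integral_quadGaussian_mul (n := n) (fun x => ℓ x * (starRingEnd ℂ) (m x))
      (fun x => (starRingEnd ℂ) (ℓ x * (starRingEnd ℂ) (m x)))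
    rw [integral_conj, Complex.mul_conj] at h2
    have h3 := congrArg Complex.re h2
    rw [Complex.ofReal_re] at h3
    rw [← h3]
    refine integral_re (𝕜 := ℂ) (f := fun z : Quad n => (ℓ z.1.1 * (starRingEnd ℂ) (m z.1.1)) *
      (starRingEnd ℂ) (ℓ z.1.2 * (starRingEnd ℂ) (m z.1.2))) ?_
    have : PolyBdd fun z : Quad n =>
      ‖(ℓ z.1.1 * (starRingEnd ℂ) (m z.1.1)) *
      (starRingEnd ℂ) (ℓ z.1.2 * (starRingEnd ℂ) (m z.1.2))‖ := by
      refine ((pl1.mul pm1).mul (pl2.mul pm2)).mono fun z => ?_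
      simp
    refine (integrable_norm_iff ?_).1 (i1 this (by fun_prop))
    exact Continuous.aestronglyMeasurable (by fun_prop)
  have e1 : ∫ z, ‖ℓ z.1.1‖ ^ 2 * ‖m z.1.1‖ ^ 2 ∂(quadGaussian n) = M :=
    integral_quadGaussian_fst (h := fun x => ‖ℓ x‖ ^ 2 * ‖m x‖ ^ 2) (by fun_prop)
  have e2 : ∫ z, ‖ℓ z.1.2‖ ^ 2 * ‖m z.1.2‖ ^ 2 ∂(quadGaussian n) = M := by
    have := integral_quadGaussian_mul (n := n) (fun _ => (1 : ℝ)) (fun x => ‖ℓ x‖ ^ 2 * ‖m x‖ ^ 2)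
    simpa using this
  have e3 : ∫ z, ‖ℓ z.1.1‖ ^ 2 * ‖m z.1.2‖ ^ 2 ∂(quadGaussian n) = A * B :=
    integral_quadGaussian_mul (n := n) (fun x => ‖ℓ x‖ ^ 2) (fun x => ‖m x‖ ^ 2)
  have e4 : ∫ z, ‖m z.1.1‖ ^ 2 * ‖ℓ z.1.2‖ ^ 2 ∂(quadGaussian n) = B * A :=
    integral_quadGaussian_mul (n := n) (fun x => ‖m x‖ ^ 2) (fun x => ‖ℓ x‖ ^ 2)
  have j1 := i1 ((pl1.pow 2).mul (pm1.pow 2)) (by fun_prop)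
  have j2 := i1 ((pl2.pow 2).mul (pm2.pow 2)) (by fun_prop)
  have j3 := i1 ((pl1.pow 2).mul (pm2.pow 2)) (by fun_prop)
  have j4 := i1 ((pm1.pow 2).mul (pl2.pow 2)) (by fun_prop)
  have j12 := i1 (((pl1.pow 2).mul (pm1.pow 2)).add ((pl2.pow 2).mul (pm2.pow 2))) (by fun_prop)
  have j123 := i1 ((((pl1.pow 2).mul (pm1.pow 2)).add ((pl2.pow 2).mul (pm2.pow 2))).add
    ((pl1.pow 2).mul (pm2.pow 2))) (by fun_prop)
  have j1234 := i1 (((((pl1.pow 2).mul (pm1.pow 2)).add ((pl2.pow 2).mul (pm2.pow 2))).add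
    ((pl1.pow 2).mul (pm2.pow 2))).add ((pm1.pow 2).mul (pl2.pow 2))) (by fun_prop)
  have j5 : Integrable (fun z : Quad n =>
      ((ℓ z.1.1 * (starRingEnd ℂ) (m z.1.1)) *
      (starRingEnd ℂ) (ℓ z.1.2 * (starRingEnd ℂ) (m z.1.2))).re) (quadGaussian n) := by
    refine i1 (((pl1.mul pm1).mul (pl2.mul pm2)).mono fun z => ?_)
      (Complex.continuous_re.comp (by fun_prop))
    refine (Complex.abs_re_le_norm _).trans ?_
    simp
  have hexp : ∫ z, (4 * (‖ℓ z.1.1‖ ^ 2 + ‖ℓ z.1.2‖ ^ 2) * (‖m z.1.1‖ ^ 2 + ‖m z.1.2‖ ^ 2)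
        - 8 * ((ℓ z.1.1 * (starRingEnd ℂ) (m z.1.1)) *
      (starRingEnd ℂ) (ℓ z.1.2 * (starRingEnd ℂ) (m z.1.2))).re) ∂(quadGaussian n)
      = 4 * (M + M + A * B + B * A) - 8 * Complex.normSq
        (∫ x, ℓ x * (starRingEnd ℂ) (m x) ∂(stdComplexGaussian n)) := by
    have : ∀ z : Quad n,
        4 * (‖ℓ z.1.1‖ ^ 2 + ‖ℓ z.1.2‖ ^ 2) * (‖m z.1.1‖ ^ 2 + ‖m z.1.2‖ ^ 2)
        - 8 * ((ℓ z.1.1 * (starRingEnd ℂ) (m z.1.1)) *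
          (starRingEnd ℂ) (ℓ z.1.2 * (starRingEnd ℂ) (m z.1.2))).re =
        4 * (‖ℓ z.1.1‖ ^ 2 * ‖m z.1.1‖ ^ 2 + ‖ℓ z.1.2‖ ^ 2 * ‖m z.1.2‖ ^ 2
          + ‖ℓ z.1.1‖ ^ 2 * ‖m z.1.2‖ ^ 2 + ‖m z.1.1‖ ^ 2 * ‖ℓ z.1.2‖ ^ 2)
        - 8 * ((ℓ z.1.1 * (starRingEnd ℂ) (m z.1.1)) *
          (starRingEnd ℂ) (ℓ z.1.2 * (starRingEnd ℂ) (m z.1.2))).re := fun z => by ring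
    simp_rw [this]
    rw [integral_sub (j1234.const_mul 4) (j5.const_mul 8),
      integral_const_mul, integral_const_mul, integral_add j123 j4,
      integral_add j12 j3, integral_add j1 j2, hcross, e1, e2, e3, e4]
  rw [hexp] at hsum
  have := Complex.normSq_nonneg (∫ x, ℓ x * (starRingEnd ℂ) (m x) ∂(stdComplexGaussian n))
  linarith

/-! ### Gaussian correlation of plurisubharmonic functions -/

section

open Filter Topology

/-- The mean of `f` over the four points `x + iᵏ v`. -/
noncomputable def rotAvg {n : ℕ} (f : (Fin n → ℂ) → ℝ) (x v : Fin n → ℂ) : ℝ :=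
  (∑ k : Fin 4, f (x + Complex.I ^ (k : ℕ) • v)) / 4

/-- Continuous functions of polynomial growth that have at each point a complex Hessian which is
a sum of squared moduli of linear forms, as the limit of difference quotients that is locally
uniform in the base point and of polynomial growth. -/
structure SmoothPSH {n : ℕ} (f : (Fin n → ℂ) → ℝ) : Prop where
  cont : Continuous f
  poly : PolyBdd f
  bound : ∃ (C : ℝ) (K : ℕ), 0 ≤ C ∧ ∀ t : ℝ, 0 < t → t ≤ 1 → ∀ x w,
    |rotAvg f x ((t : ℂ) • w) - f x| ≤ C * t ^ 2 * (1 + ‖x‖ + ‖w‖) ^ K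
  levi : ∀ x₀, ∃ (m : ℕ) (ℓ : Fin m → ((Fin n → ℂ) →ₗ[ℂ] ℂ)), ∀ (w : Fin n → ℂ)
    (x : ℝ → Fin n → ℂ), Tendsto x (𝓝[>] 0) (𝓝 x₀) →
      Tendsto (fun t : ℝ => (rotAvg f (x t) ((t : ℂ) • w) - f (x t)) / t ^ 2) (𝓝[>] 0)
        (𝓝 (∑ i, ‖ℓ i w‖ ^ 2))

lemma continuous_rotAvg {n : ℕ} {f : (Fin n → ℂ) → ℝ} (hf : Continuous f) :
    Continuous fun p : (Fin n → ℂ) × (Fin n → ℂ) => rotAvg f p.1 p.2 := by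
  unfold rotAvg; fun_prop

/-- Two sums of squared moduli of linear forms are positively correlated. -/
lemma integral_sum_norm_sq_mul_sub_nonneg {n m m' : ℕ} (ℓ : Fin m → ((Fin n → ℂ) →ₗ[ℂ] ℂ))
    (ℓ' : Fin m' → ((Fin n → ℂ) →ₗ[ℂ] ℂ)) :
    0 ≤ ∫ p, (∑ i, ‖ℓ i p.1‖ ^ 2) * ((∑ i, ‖ℓ' i p.1‖ ^ 2) - ∑ i, ‖ℓ' i p.2‖ ^ 2)
      ∂((stdComplexGaussian n).prod (stdComplexGaussian n)) := by
  have cℓ := fun i => continuous_linear (ℓ i)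
  have cℓ' := fun i => continuous_linear (ℓ' i)
  have pA : PolyBdd fun x => ∑ i, ‖ℓ i x‖ ^ 2 :=
    PolyBdd.sum _ fun i _ => (polyBdd_norm_linear (ℓ i)).pow 2
  have pB : PolyBdd fun x => ∑ i, ‖ℓ' i x‖ ^ 2 :=
    PolyBdd.sum _ fun i _ => (polyBdd_norm_linear (ℓ' i)).pow 2
  have iA := pA.integrable_stdComplexGaussian (by fun_prop)
  have iB := pB.integrable_stdComplexGaussian (by fun_prop)
  have iAB := (pA.mul pB).integrable_stdComplexGaussian (by fun_prop)
  simp_rw [mul_sub]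
  rw [integral_sub (iAB.comp_fst _) (iA.mul_prod iB),
    integral_prod_mul (f := fun x => ∑ i, ‖ℓ i x‖ ^ 2) (g := fun x => ∑ i, ‖ℓ' i x‖ ^ 2),
    integral_fun_fst (f := fun x => (∑ i, ‖ℓ i x‖ ^ 2) * ∑ i, ‖ℓ' i x‖ ^ 2)]
  simp only [probReal_univ, one_smul, sub_nonneg]
  simp_rw [Finset.sum_mul_sum]
  have h1 : ∀ i j, Integrable (fun x => ‖ℓ i x‖ ^ 2 * ‖ℓ' j x‖ ^ 2) (stdComplexGaussian n) :=
    fun i j => (((polyBdd_norm_linear (ℓ i)).pow 2).mul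
      ((polyBdd_norm_linear (ℓ' j)).pow 2)).integrable_stdComplexGaussian (by fun_prop)
  rw [integral_finsetSum _ fun i _ =>
      ((polyBdd_norm_linear (ℓ i)).pow 2).integrable_stdComplexGaussian (by fun_prop),
    integral_finsetSum _ fun i _ =>
      ((polyBdd_norm_linear (ℓ' i)).pow 2).integrable_stdComplexGaussian (by fun_prop),
    Finset.sum_mul_sum,
    integral_finsetSum _ fun i _ => integrable_finsetSum _ fun j _ => h1 i j]
  refine Finset.sum_le_sum fun i _ => ?_
  rw [integral_finsetSum _ fun j _ => h1 i j]
  exact Finset.sum_le_sum fun j _ => integral_norm_sq_mul_norm_sq_ge _ _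

section Correlation

variable {n : ℕ} {f g : (Fin n → ℂ) → ℝ}

/-- `E f(X) g(Y)` for standard complex Gaussian vectors `X`, `Y` with `E Y X* = c`. -/
noncomputable def gaussCorr (f g : (Fin n → ℂ) → ℝ) (c : ℂ) : ℝ :=
  ∫ z, f z.1.1 * g (c • z.1.1 + ((√(1 - ‖c‖ ^ 2) : ℝ) : ℂ) • z.1.2) ∂(quadGaussian n)

lemma gaussCorr_zero : gaussCorr f g 0 =
    (∫ x, f x ∂(stdComplexGaussian n)) * ∫ x, g x ∂(stdComplexGaussian n) := by
  simp [gaussCorr, integral_quadGaussian_mul]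

lemma gaussCorr_of_norm_eq_one (hf : Continuous f) (hg : Continuous g)
    (hrot : ∀ (c : ℂ) x, ‖c‖ = 1 → g (c • x) = g x) {c : ℂ} (hc : ‖c‖ = 1) :
    gaussCorr f g c = ∫ x, f x * g x ∂(stdComplexGaussian n) := by
  rw [← integral_quadGaussian_fst (h := fun x => f x * g x) (hf.mul hg)]
  simp [gaussCorr, hc, hrot]

/-- The Gram matrix determines the joint law. The conjugate on c appears because ∑ a b̄ is the
covariance E X Y*, whereas c is E Y X*. -/
lemma integral_lincomb_eq_gaussCorr (hf : Continuous f) (hg : Continuous g) {a b : Fin 4 → ℂ}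
    {c : ℂ} (hc : ‖c‖ ≤ 1) (ha : ∑ i, ‖a i‖ ^ 2 = 1) (hb : ∑ i, ‖b i‖ ^ 2 = 1)
    (hab : ∑ i, a i * (starRingEnd ℂ) (b i) = (starRingEnd ℂ) c) :
    ∫ z, f (lincomb a z) * g (lincomb b z) ∂(quadGaussian n) = gaussCorr f g c := by
  have h1 : 0 ≤ 1 - ‖c‖ ^ 2 := by
    have := norm_nonneg c
    nlinarith
  have h := integral_lincomb_eq (n := n) (a := a) (b := b) (a' := ![1, 0, 0, 0])
    (b' := ![c, ((√(1 - ‖c‖ ^ 2) : ℝ) : ℂ), 0, 0]) (by rw [ha]; simp [Fin.sum_univ_four])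
    (by rw [hb]; simp [Fin.sum_univ_four, Real.sq_sqrt h1])
    (by rw [hab]; simp [Fin.sum_univ_four]) (F := fun x y => f x * g y) (by fun_prop)
  rw [h, gaussCorr]
  simp [lincomb]

lemma polyBdd_lincomb (a : Fin 4 → ℂ) : PolyBdd fun z : Quad n => ‖lincomb a z‖ :=
  PolyBdd.norm_clm (lincombL a)

lemma integrable_lincomb_mul (hf : SmoothPSH f) (hg : SmoothPSH g) (a b : Fin 4 → ℂ) :
    Integrable (fun z => f (lincomb a z) * g (lincomb b z)) (quadGaussian n) :=
  ((hf.poly.comp (polyBdd_lincomb a)).mul (hg.poly.comp (polyBdd_lincomb b))).integrable_quadGaussian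
    ((hf.cont.comp (continuous_lincomb a)).mul (hg.cont.comp (continuous_lincomb b)))

lemma continuousOn_gaussCorr (hf : SmoothPSH f) (hg : SmoothPSH g) :
    ContinuousOn (gaussCorr f g) (Metric.closedBall 0 1) := by
  have cf := hf.cont
  have cg := hg.cont
  obtain ⟨C, K, hC, hb⟩ := hf.poly
  obtain ⟨D, M, hD, hb'⟩ := hg.poly
  refine continuousOn_of_dominated
    (bound := fun z => (C * D * 2 ^ M) * (1 + ‖z‖) ^ (K + M)) ?_ ?_
    ((integrable_norm_pow_quadGaussian n _).const_mul _) ?_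
  · intro c _
    exact Continuous.aestronglyMeasurable (by fun_prop)
  · intro c hc
    refine Eventually.of_forall fun z => ?_
    have hc1 : ‖c‖ ≤ 1 := by simpa using hc
    have hs : √(1 - ‖c‖ ^ 2) ≤ 1 := by
      exact Real.sqrt_le_one.2 (by nlinarith [sq_nonneg ‖c‖])
    have h1 : ‖z.1.1‖ ≤ ‖z‖ := (norm_fst_le z.1).trans (norm_fst_le z)
    have h2 : ‖z.1.2‖ ≤ ‖z‖ := (norm_snd_le z.1).trans (norm_fst_le z)
    have h3 : ‖c • z.1.1 + ((√(1 - ‖c‖ ^ 2) : ℝ) : ℂ) • z.1.2‖ ≤ 2 * ‖z‖ := by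
      refine (norm_add_le _ _).trans ?_
      rw [norm_smul, norm_smul, Complex.norm_real, Real.norm_of_nonneg (Real.sqrt_nonneg _)]
      have := mul_le_of_le_one_left (norm_nonneg z.1.1) hc1
      have := mul_le_of_le_one_left (norm_nonneg z.1.2) hs
      linarith
    rw [norm_mul, Real.norm_eq_abs, Real.norm_eq_abs]
    have hz := norm_nonneg z
    calc _ ≤ (C * (1 + ‖z.1.1‖) ^ K)
          * (D * (1 + ‖c • z.1.1 + ((√(1 - ‖c‖ ^ 2) : ℝ) : ℂ) • z.1.2‖) ^ M) :=
          mul_le_mul (hb _) (hb' _) (abs_nonneg _) (by positivity)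
      _ ≤ (C * (1 + ‖z‖) ^ K) * (D * (2 * (1 + ‖z‖)) ^ M) := by
          gcongr
          linarith
      _ = _ := by rw [mul_pow, pow_add]; ring
  · refine Eventually.of_forall fun z => Continuous.continuousOn ?_
    fun_prop

lemma rotation_incr_expand (u u' : Fin 4 → ℝ) (v : Fin 4 → ℝ) (y : ℝ) :
    ((∑ k, v k) / 4 - y) * ((∑ k, u k) / 4 - (∑ k, u' k) / 4) =
      (∑ l, ∑ m, (v l * u m - v l * u' m)) / 16 - (∑ m, (y * u m - y * u' m)) / 4 := by
  simp only [Fin.sum_univ_four]; ring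

/-- Multiplication by the conjugate of iˡ permutes the fourth roots of unity. -/
lemma sum_rotations_conj (q : ℂ → ℝ) (c r : ℂ) (l : Fin 4) :
    ∑ m : Fin 4, q (c + r * (Complex.I ^ (m : ℕ) * (starRingEnd ℂ) (Complex.I ^ (l : ℕ)))) =
      ∑ k : Fin 4, q (c + r * Complex.I ^ (k : ℕ)) := by
  have h3' : Complex.I ^ 3 = -Complex.I := by rw [pow_succ, Complex.I_sq]; ring
  have h3 : Complex.I ^ ((3 : Fin 4) : ℕ) = -Complex.I := h3'
  fin_cases l <;>
    simp only [Fin.sum_univ_four, Fin.isValue, Fin.val_zero, Fin.val_one, Fin.val_two, h3, h3', pow_zero, pow_one, Complex.I_sq, map_one,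
      map_neg, Complex.conj_I, mul_neg, neg_mul, neg_neg, mul_one, one_mul, Complex.I_mul_I] <;>
    ring

/-- The four-point defect of |c|² at radius t² is exactly t⁴, which makes it the strictly
subharmonic perturbation in the maximum principle. -/
lemma sum_norm_sq_rotations (c : ℂ) (t : ℝ) :
    ∑ k : Fin 4, ‖c + t ^ 2 * Complex.I ^ (k : ℕ)‖ ^ 2 = 4 * (‖c‖ ^ 2 + t ^ 4) := by
  rw [← Complex.ofReal_pow]
  simp only [Fin.sum_univ_four, Complex.sq_norm, Complex.normSq_apply]
  simp [pow_succ]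
  ring

/-- The defect in the four-point mean value property of `gaussCorr f g`. -/
lemma integral_rotAvg_mul (hf : SmoothPSH f) (hg : SmoothPSH g) {c : ℂ} {t : ℝ} (ht : 0 < t)
    (hct : ‖c‖ ≤ 1 - t ^ 2) (ht1 : t < 1) :
    ∫ z, (rotAvg f (((√(1 - t ^ 2) : ℝ) : ℂ) • z.1.1) ((t : ℂ) • z.2.1)
          - f (((√(1 - t ^ 2) : ℝ) : ℂ) • z.1.1)) *
        (rotAvg g ((c / ((√(1 - t ^ 2) : ℝ) : ℂ)) • z.1.1
            + ((√(1 - t ^ 2 - ‖c‖ ^ 2 / (1 - t ^ 2)) : ℝ) : ℂ) • z.1.2) ((t : ℂ) • z.2.1)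
          - rotAvg g ((c / ((√(1 - t ^ 2) : ℝ) : ℂ)) • z.1.1
            + ((√(1 - t ^ 2 - ‖c‖ ^ 2 / (1 - t ^ 2)) : ℝ) : ℂ) • z.1.2) ((t : ℂ) • z.2.2))
        ∂(quadGaussian n)
      = (∑ k : Fin 4, gaussCorr f g (c + t ^ 2 * Complex.I ^ (k : ℕ))) / 4 - gaussCorr f g c := by
  have hr : 0 < 1 - t ^ 2 := by nlinarith
  set s : ℂ := ((√(1 - t ^ 2) : ℝ) : ℂ) with hs
  set τ : ℂ := ((√(1 - t ^ 2 - ‖c‖ ^ 2 / (1 - t ^ 2)) : ℝ) : ℂ) with hτ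
  have hsn : ‖s‖ ^ 2 = 1 - t ^ 2 := by
    rw [hs, Complex.norm_real, Real.norm_eq_abs, sq_abs, Real.sq_sqrt hr.le]
  have hs0 : s ≠ 0 := by
    intro h; rw [h] at hsn; simp at hsn; linarith
  have hsc : (starRingEnd ℂ) s = s := Complex.conj_ofReal _
  have hτn : ‖τ‖ ^ 2 = 1 - t ^ 2 - ‖c‖ ^ 2 / (1 - t ^ 2) := by
    rw [hτ, Complex.norm_real, Real.norm_eq_abs, sq_abs, Real.sq_sqrt]
    rw [sub_nonneg, div_le_iff₀ hr]
    nlinarith [norm_nonneg c]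
  have hI : ∀ k : ℕ, ‖Complex.I ^ k‖ = 1 := fun k => by simp
  -- The scalars s, c/s and τ make `a`, `b`, `b'` unit vectors. The base points alone have
  -- covariance c. An increment along the shared third vector, in `a` and `b`, adds t² iᵐ times the
  -- conjugate of iˡ; in `b'` the increment uses the independent fourth vector and adds nothing. The
  -- row `a₀` carries no increment.
  let a : Fin 4 → Fin 4 → ℂ := fun l => ![s, 0, Complex.I ^ (l : ℕ) * t, 0]
  let a₀ : Fin 4 → ℂ := ![s, 0, 0, 0]
  let b : Fin 4 → Fin 4 → ℂ := fun m => ![c / s, τ, Complex.I ^ (m : ℕ) * t, 0]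
  let b' : Fin 4 → Fin 4 → ℂ := fun m => ![c / s, τ, 0, Complex.I ^ (m : ℕ) * t]
  have ha : ∀ l, ∑ i, ‖a l i‖ ^ 2 = 1 := by
    intro l
    simp [a, Fin.sum_univ_four, hsn]
  have hb : ∀ l, ∑ i, ‖b l i‖ ^ 2 = 1 := by
    intro l
    simp [b, Fin.sum_univ_four, hsn, hτn, div_pow]
  have hb' : ∀ l, ∑ i, ‖b' l i‖ ^ 2 = 1 := by
    intro l
    simp [b', Fin.sum_univ_four, hsn, hτn, div_pow]
  have hcan : s * ((starRingEnd ℂ) c / s) = (starRingEnd ℂ) c := by field_simp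
  have J1 : ∀ l m, ∫ z, f (lincomb (a l) z) * g (lincomb (b m) z) ∂(quadGaussian n)
      = gaussCorr f g (c + t ^ 2 * (Complex.I ^ (m : ℕ) * (starRingEnd ℂ) (Complex.I ^ (l : ℕ)))) := by
    intro l m
    refine integral_lincomb_eq_gaussCorr hf.cont hg.cont ?_ (ha l) (hb m) ?_
    · refine (norm_add_le _ _).trans ?_
      rw [norm_mul, norm_mul, RCLike.norm_conj, hI, hI, norm_pow, Complex.norm_real,
        Real.norm_eq_abs, sq_abs]
      linarith
    · simp [a, b, Fin.sum_univ_four, hsc, hcan]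
      ring
  have J2 : ∀ l m, ∫ z, f (lincomb (a l) z) * g (lincomb (b' m) z) ∂(quadGaussian n)
      = gaussCorr f g c := by
    intro l m
    refine integral_lincomb_eq_gaussCorr hf.cont hg.cont (by nlinarith) (ha l) (hb' m) ?_
    simp [a, b', Fin.sum_univ_four, hsc, hcan]
  -- Without an increment in f, it is immaterial which of the two vectors moves g, so the terms
  -- coming from the subtracted f cancel.
  have J3 : ∀ m, ∫ z, f (lincomb a₀ z) * g (lincomb (b m) z) ∂(quadGaussian n)
      = ∫ z, f (lincomb a₀ z) * g (lincomb (b' m) z) ∂(quadGaussian n) := by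
    intro m
    refine integral_lincomb_eq rfl (by rw [hb, hb']) ?_ (F := fun x y => f x * g y) ?_
    · simp [a₀, b, b', Fin.sum_univ_four]
    · have := hf.cont
      have := hg.cont
      fun_prop
  have hI2 : ∀ a b, Integrable (fun z => f (lincomb a z) * g (lincomb b z)) (quadGaussian n) :=
    integrable_lincomb_mul hf hg
  have hI3 : ∀ a b b', Integrable (fun z => f (lincomb a z) * g (lincomb b z)
      - f (lincomb a z) * g (lincomb b' z)) (quadGaussian n) :=
    fun a b b' => (hI2 a b).sub (hI2 a b')
  have hpt : ∀ z : Quad n, (rotAvg f (s • z.1.1) ((t : ℂ) • z.2.1) - f (s • z.1.1)) *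
      (rotAvg g ((c / s) • z.1.1 + τ • z.1.2) ((t : ℂ) • z.2.1)
        - rotAvg g ((c / s) • z.1.1 + τ • z.1.2) ((t : ℂ) • z.2.2)) =
      (∑ l, ∑ m, (f (lincomb (a l) z) * g (lincomb (b m) z)
          - f (lincomb (a l) z) * g (lincomb (b' m) z))) / 16
        - (∑ m, (f (lincomb a₀ z) * g (lincomb (b m) z)
          - f (lincomb a₀ z) * g (lincomb (b' m) z))) / 4 := by
    intro z
    rw [← rotation_incr_expand]
    simp only [rotAvg, lincomb, a, a₀, b, b', Matrix.cons_val, zero_smul, add_zero, smul_smul]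
  simp_rw [hpt]
  rw [integral_sub, integral_div, integral_div, integral_finsetSum, integral_finsetSum]
  · have e1 : ∀ l, ∫ z, ∑ m, (f (lincomb (a l) z) * g (lincomb (b m) z)
          - f (lincomb (a l) z) * g (lincomb (b' m) z)) ∂(quadGaussian n) =
        ∑ m : Fin 4, (gaussCorr f g (c + t ^ 2 * (Complex.I ^ (m : ℕ)
          * (starRingEnd ℂ) (Complex.I ^ (l : ℕ)))) - gaussCorr f g c) := by
      intro l
      rw [integral_finsetSum _ fun m _ => hI3 _ _ _]
      refine Finset.sum_congr rfl fun m _ => ?_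
      rw [integral_sub (hI2 _ _) (hI2 _ _), J1, J2]
    have e2 : ∀ m, ∫ z, (f (lincomb a₀ z) * g (lincomb (b m) z)
          - f (lincomb a₀ z) * g (lincomb (b' m) z)) ∂(quadGaussian n) = 0 := by
      intro m
      rw [integral_sub (hI2 _ _) (hI2 _ _), J3, sub_self]
    simp_rw [e1, e2, Finset.sum_sub_distrib, sum_rotations_conj, Finset.sum_const]
    simp only [Finset.card_univ, Fintype.card_fin, nsmul_eq_mul, mul_zero, zero_div]
    push_cast
    ring
  · exact fun m _ => hI3 _ _ _
  · exact fun l _ => integrable_finsetSum _ fun m _ => hI3 _ _ _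
  · exact (integrable_finsetSum _ fun l _ => integrable_finsetSum _ fun m _ =>
      hI3 _ _ _).div_const _
  · exact (integrable_finsetSum _ fun m _ => hI3 _ _ _).div_const _

/-- The defect is an integral of a product of two increments, each of order t². Dominated
convergence replaces the quotients by the complex Hessians at the limiting base points; for fixed
base points, the integral over the two directions is a covariance of sums of squared moduli, hence
nonnegative. -/
lemma tendsto_gaussCorr_defect (hf : SmoothPSH f) (hg : SmoothPSH g) {c : ℂ} (hc : ‖c‖ < 1) :
    ∃ L : ℝ, 0 ≤ L ∧ Tendsto (fun t : ℝ =>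
      ((∑ k : Fin 4, gaussCorr f g (c + t ^ 2 * Complex.I ^ (k : ℕ))) / 4 - gaussCorr f g c)
        / t ^ 4) (𝓝[>] 0) (𝓝 L) := by
  choose mf ℓf hlf using hf.levi
  choose mg ℓg hlg using hg.levi
  obtain ⟨C, K, hC, hbf⟩ := hf.bound
  obtain ⟨D, M, hD, hbg⟩ := hg.bound
  have cf := continuous_rotAvg hf.cont
  have cg := continuous_rotAvg hg.cont
  have cf' := hf.cont
  have cg' := hg.cont
  set Y : Quad n → (Fin n → ℂ) :=
    fun z => c • z.1.1 + ((√(1 - ‖c‖ ^ 2) : ℝ) : ℂ) • z.1.2 with hY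
  set A : (Fin n → ℂ) → (Fin n → ℂ) → ℝ := fun x w => ∑ i, ‖ℓf x i w‖ ^ 2
  set B : (Fin n → ℂ) → (Fin n → ℂ) → ℝ := fun x w => ∑ i, ‖ℓg x i w‖ ^ 2
  set xt : ℝ → Quad n → (Fin n → ℂ) := fun t z => ((√(1 - t ^ 2) : ℝ) : ℂ) • z.1.1 with hxt
  set yt : ℝ → Quad n → (Fin n → ℂ) := fun t z => (c / ((√(1 - t ^ 2) : ℝ) : ℂ)) • z.1.1
            + ((√(1 - t ^ 2 - ‖c‖ ^ 2 / (1 - t ^ 2)) : ℝ) : ℂ) • z.1.2 with hyt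
  have hsmall : ∀ᶠ t : ℝ in 𝓝[>] 0, 0 < t ∧ t < 1 ∧ ‖c‖ ≤ 1 - t ^ 2 := by
    have h1 : ∀ᶠ t : ℝ in 𝓝[>] 0, t < 1 :=
      nhdsWithin_le_nhds (eventually_lt_nhds one_pos)
    have h2 : ∀ᶠ t : ℝ in 𝓝[>] 0, ‖c‖ < 1 - t ^ 2 := by
      have : Tendsto (fun t : ℝ => 1 - t ^ 2) (𝓝 0) (𝓝 (1 - 0 ^ 2)) := by
        apply Continuous.tendsto; fun_prop
      exact nhdsWithin_le_nhds (this.eventually_const_lt (by simpa using hc))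
    filter_upwards [h1, h2, self_mem_nhdsWithin] with t a b d using ⟨d, a, b.le⟩
  refine ⟨∫ z, A z.1.1 z.2.1 * (B (Y z) z.2.1 - B (Y z) z.2.2) ∂(quadGaussian n), ?_, ?_⟩
  -- Integrability is only needed for Fubini: in its absence the integral is 0 by convention.
  · by_cases hi : Integrable (fun z : Quad n =>
        A z.1.1 z.2.1 * (B (Y z) z.2.1 - B (Y z) z.2.2)) (quadGaussian n)
    · rw [quadGaussian] at hi ⊢
      rw [integral_prod _ hi]
      refine integral_nonneg fun p => ?_
      exact integral_sum_norm_sq_mul_sub_nonneg (ℓf p.1)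
        (ℓg (c • p.1 + ((√(1 - ‖c‖ ^ 2) : ℝ) : ℂ) • p.2))
    · rw [integral_undef hi]
  -- The value of g at the base point is subtracted from both rotated means, so that each becomes a
  -- difference quotient. The base points themselves move with t, whence the moving base point in
  -- the `levi` field.
  have hlim : Tendsto (fun t : ℝ => ∫ z, ((rotAvg f (xt t z) ((t : ℂ) • z.2.1) - f (xt t z)) / t ^ 2)
      * ((rotAvg g (yt t z) ((t : ℂ) • z.2.1) - g (yt t z)) / t ^ 2
        - (rotAvg g (yt t z) ((t : ℂ) • z.2.2) - g (yt t z)) / t ^ 2) ∂(quadGaussian n))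
      (𝓝[>] 0) (𝓝 (∫ z, A z.1.1 z.2.1 * (B (Y z) z.2.1 - B (Y z) z.2.2) ∂(quadGaussian n))) := by
    refine tendsto_integral_filter_of_dominated_convergence
      (fun z => (2 * C * D * 3 ^ (K + M)) * (1 + ‖z‖) ^ (K + M)) ?_ ?_
      ((integrable_norm_pow_quadGaussian n _).const_mul _) ?_
    · refine Eventually.of_forall fun t => Continuous.aestronglyMeasurable ?_
      have c1 : Continuous (xt t) := by rw [hxt]; fun_prop
      have c2 : Continuous (yt t) := by rw [hyt]; fun_prop
      have c3 : Continuous fun z => rotAvg f (xt t z) ((t : ℂ) • z.2.1) :=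
        cf.comp (c1.prodMk (by fun_prop))
      have c4 : Continuous fun z => rotAvg g (yt t z) ((t : ℂ) • z.2.1) :=
        cg.comp (c2.prodMk (by fun_prop))
      have c5 : Continuous fun z => rotAvg g (yt t z) ((t : ℂ) • z.2.2) :=
        cg.comp (c2.prodMk (by fun_prop))
      fun_prop
    · filter_upwards [hsmall] with t ⟨ht0, ht1, htc⟩
      refine Eventually.of_forall fun z => ?_
      have hr : 0 < 1 - t ^ 2 := by nlinarith
      have hz := norm_nonneg z
      have z1 : ‖z.1.1‖ ≤ ‖z‖ := (norm_fst_le z.1).trans (norm_fst_le z)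
      have z2 : ‖z.1.2‖ ≤ ‖z‖ := (norm_snd_le z.1).trans (norm_fst_le z)
      have z3 : ‖z.2.1‖ ≤ ‖z‖ := (norm_fst_le z.2).trans (norm_snd_le z)
      have z4 : ‖z.2.2‖ ≤ ‖z‖ := (norm_snd_le z.2).trans (norm_snd_le z)
      have hs1 : √(1 - t ^ 2) ≤ 1 := Real.sqrt_le_one.2 (by nlinarith)
      have hs2 : 1 - t ^ 2 ≤ √(1 - t ^ 2) := by
        apply Real.le_sqrt_of_sq_le; nlinarith
      have hs0 : 0 < √(1 - t ^ 2) := Real.sqrt_pos.2 hr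
      have hx : ‖xt t z‖ ≤ ‖z‖ := by
        rw [hxt]
        simp only [norm_smul, Complex.norm_real, Real.norm_of_nonneg (Real.sqrt_nonneg _)]
        exact (mul_le_of_le_one_left (norm_nonneg _) hs1).trans z1
      have hy : ‖yt t z‖ ≤ 2 * ‖z‖ := by
        rw [hyt]
        refine (norm_add_le _ _).trans ?_
        simp only [norm_smul, norm_div, Complex.norm_real,
          Real.norm_of_nonneg (Real.sqrt_nonneg _)]
        have h1 : ‖c‖ / √(1 - t ^ 2) ≤ 1 := (div_le_one hs0).2 (htc.trans hs2)
        have h2 : √(1 - t ^ 2 - ‖c‖ ^ 2 / (1 - t ^ 2)) ≤ 1 := by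
          apply Real.sqrt_le_one.2
          have : 0 ≤ ‖c‖ ^ 2 / (1 - t ^ 2) := by positivity
          nlinarith
        have := mul_le_of_le_one_left (norm_nonneg z.1.1) h1
        have := mul_le_of_le_one_left (norm_nonneg z.1.2) h2
        linarith
      have key : ∀ {h : (Fin n → ℂ) → ℝ} {C' : ℝ} {K' : ℕ} (_ : 0 ≤ C') (_ : ∀ t : ℝ, 0 < t → t ≤ 1 →
          ∀ x w, |rotAvg h x ((t : ℂ) • w) - h x| ≤ C' * t ^ 2 * (1 + ‖x‖ + ‖w‖) ^ K')
          {x w : Fin n → ℂ} (_ : ‖x‖ ≤ 2 * ‖z‖) (_ : ‖w‖ ≤ ‖z‖),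
          |(rotAvg h x ((t : ℂ) • w) - h x) / t ^ 2| ≤ C' * (3 * (1 + ‖z‖)) ^ K' := by
        intro h C' K' hC' hb x w hx hw
        rw [abs_div, abs_of_pos (pow_pos ht0 2), div_le_iff₀ (pow_pos ht0 2)]
        refine (hb t ht0 ht1.le x w).trans ?_
        have : (1 + ‖x‖ + ‖w‖) ^ K' ≤ (3 * (1 + ‖z‖)) ^ K' := by
          gcongr; linarith
        calc C' * t ^ 2 * (1 + ‖x‖ + ‖w‖) ^ K' ≤ C' * t ^ 2 * (3 * (1 + ‖z‖)) ^ K' := by gcongr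
          _ = _ := by ring
      rw [norm_mul, Real.norm_eq_abs, Real.norm_eq_abs]
      have b1 := key hC hbf (x := xt t z) (w := z.2.1) (by linarith) z3
      have b2 := key hD hbg (x := yt t z) (w := z.2.1) hy z3
      have b3 := key hD hbg (x := yt t z) (w := z.2.2) hy z4
      calc _ ≤ (C * (3 * (1 + ‖z‖)) ^ K)
            * (D * (3 * (1 + ‖z‖)) ^ M + D * (3 * (1 + ‖z‖)) ^ M) :=
            mul_le_mul b1 ((abs_sub _ _).trans (add_le_add b2 b3)) (abs_nonneg _) (by positivity)
        _ = _ := by rw [mul_pow, mul_pow, pow_add, pow_add]; ring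
    · refine Eventually.of_forall fun z => ?_
      have tx : Tendsto (fun t => xt t z) (𝓝[>] 0) (𝓝 z.1.1) := by
        have : ContinuousAt (fun t => xt t z) 0 := by
          rw [hxt]; fun_prop
        have h := this.tendsto.mono_left (nhdsWithin_le_nhds (s := Set.Ioi 0))
        simpa [hxt] using h
      have ty : Tendsto (fun t => yt t z) (𝓝[>] 0) (𝓝 (Y z)) := by
        have : ContinuousAt (fun t => yt t z) 0 := by
          rw [hyt]
          have k1 : ContinuousAt (fun t : ℝ => c / ((√(1 - t ^ 2) : ℝ) : ℂ)) 0 :=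
            ContinuousAt.div₀ (by fun_prop) (by fun_prop) (by simp)
          have k2 : ContinuousAt (fun t : ℝ => ‖c‖ ^ 2 / (1 - t ^ 2)) 0 :=
            ContinuousAt.div₀ (by fun_prop) (by fun_prop) (by simp)
          fun_prop
        have h := this.tendsto.mono_left (nhdsWithin_le_nhds (s := Set.Ioi 0))
        simpa [hyt, hY] using h
      exact (hlf _ _ _ tx).mul ((hlg _ _ _ ty).sub (hlg _ _ _ ty))
  refine hlim.congr' ?_
  filter_upwards [hsmall] with t ⟨ht0, ht1, htc⟩
  rw [← integral_rotAvg_mul hf hg ht0 htc ht1, ← integral_div]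
  have ht : t ≠ 0 := ht0.ne'
  have e : ∀ F G₁ G₂ g₀ : ℝ, F / t ^ 2 * ((G₁ - g₀) / t ^ 2 - (G₂ - g₀) / t ^ 2)
      = F * (G₁ - G₂) / t ^ 4 := by
    intro F G₁ G₂ g₀
    field_simp
    ring
  congr 1; ext z
  exact e _ _ _ _

/-- Circular plurisubharmonic functions are positively correlated under the complex Gaussian
measure. -/
theorem SmoothPSH.integral_mul_ge (hf : SmoothPSH f) (hg : SmoothPSH g)
    (hrot : ∀ (c : ℂ) x, ‖c‖ = 1 → g (c • x) = g x) :
    (∫ x, f x ∂(stdComplexGaussian n)) * (∫ x, g x ∂(stdComplexGaussian n)) ≤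
      ∫ x, f x * g x ∂(stdComplexGaussian n) := by
  rw [← gaussCorr_zero]
  -- Maximum principle: the maximum of F(c) + δ|c|² over the closed disc cannot be interior. Such a
  -- maximum would force the defect of F to be at most -δt⁴, whereas its quotient by t⁴ has a
  -- nonnegative limit.
  refine le_of_forall_pos_le_add fun δ hδ => ?_
  obtain ⟨c, hc, hmax⟩ := (isCompact_closedBall (0 : ℂ) 1).exists_isMaxOn
    (Metric.nonempty_closedBall.2 zero_le_one)
    (f := fun c => gaussCorr f g c + δ * ‖c‖ ^ 2)
    ((continuousOn_gaussCorr hf hg).add (by fun_prop))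
  have hc1 : ‖c‖ ≤ 1 := by simpa using hc
  rcases hc1.lt_or_eq with hlt | heq
  · exfalso
    obtain ⟨L, hL, hlim⟩ := tendsto_gaussCorr_defect hf hg hlt
    have h1 : ∀ᶠ t : ℝ in 𝓝[>] 0, -δ <
        ((∑ k : Fin 4, gaussCorr f g (c + t ^ 2 * Complex.I ^ (k : ℕ))) / 4 - gaussCorr f g c)
        / t ^ 4 := hlim.eventually_const_lt (by linarith)
    have h2 : ∀ᶠ t : ℝ in 𝓝[>] 0, ‖c‖ < 1 - t ^ 2 := by
      have : Tendsto (fun t : ℝ => 1 - t ^ 2) (𝓝 0) (𝓝 (1 - 0 ^ 2)) := by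
        apply Continuous.tendsto; fun_prop
      exact nhdsWithin_le_nhds (this.eventually_const_lt (by simpa using hlt))
    obtain ⟨t, ht1, ht2, ht0⟩ := (h1.and (h2.and self_mem_nhdsWithin)).exists
    have ht0 : 0 < t := ht0
    rw [lt_div_iff₀ (by positivity)] at ht1
    have hle : ∀ k : Fin 4, gaussCorr f g (c + t ^ 2 * Complex.I ^ (k : ℕ))
        + δ * ‖c + t ^ 2 * Complex.I ^ (k : ℕ)‖ ^ 2 ≤ gaussCorr f g c + δ * ‖c‖ ^ 2 := by
      intro k
      apply hmax
      rw [mem_closedBall_zero_iff]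
      refine (norm_add_le _ _).trans ?_
      simp only [norm_mul, norm_pow, Complex.norm_real, Complex.norm_I, one_pow, mul_one,
        Real.norm_eq_abs, sq_abs]
      linarith
    have hsum := Finset.sum_le_sum fun k (_ : k ∈ Finset.univ) => hle k
    rw [Finset.sum_add_distrib, ← Finset.mul_sum, sum_norm_sq_rotations] at hsum
    simp only [Finset.sum_const, Finset.card_univ, Fintype.card_fin, nsmul_eq_mul] at hsum
    push_cast at hsum
    nlinarith
  -- On the boundary F equals E fg by circularity; comparison with the centre costs only δ.
  · have h0 := hmax (Metric.mem_closedBall_self zero_le_one)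
    simp only [norm_zero, heq, Set.mem_ofPred_eq] at h0
    rw [gaussCorr_of_norm_eq_one hf.cont hg.cont hrot heq] at h0
    linarith

end Correlation

end

/-! ### Regularized products of powers and their complex Hessian -/

section

open Filter Topology

/-- Taylor's formula of order two with Lagrange remainder, at a critical zero. -/
lemma exists_eq_sq_div_two_mul {φ φ' φ'' : ℝ → ℝ} (h : ∀ t, HasDerivAt φ (φ' t) t)
    (h' : ∀ t, HasDerivAt φ' (φ'' t) t) (h0 : φ 0 = 0) (h0' : φ' 0 = 0) {t : ℝ} (ht : 0 < t) :
    ∃ ξ, 0 < ξ ∧ ξ < t ∧ φ t = t ^ 2 / 2 * φ'' ξ := by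
  -- Cauchy's mean value theorem against x², followed by the ordinary one for φ'.
  obtain ⟨η, ⟨hη0, hηt⟩, hη⟩ := exists_ratio_hasDerivAt_eq_ratio_slope φ φ' ht
    (fun x _ => (h x).continuousAt.continuousWithinAt) (fun x _ => h x)
    (fun x => x ^ 2) (fun x => 2 * x) (by fun_prop)
    (fun x _ => by simpa using hasDerivAt_pow 2 x)
  obtain ⟨ξ, ⟨hξ0, hξη⟩, hξ⟩ := exists_hasDerivAt_eq_slope φ' φ'' hη0
    (fun x _ => (h' x).continuousAt.continuousWithinAt) (fun x _ => h' x)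
  refine ⟨ξ, hξ0, hξη.trans hηt, ?_⟩
  rw [h0', sub_zero, sub_zero, eq_div_iff hη0.ne'] at hξ
  simp only [h0, sub_zero, ne_eq, OfNat.ofNat_ne_zero, not_false_eq_true, zero_pow] at hη
  rw [← hξ] at hη
  have : (φ t - t ^ 2 / 2 * φ'' ξ) * (2 * η) = 0 := by linear_combination -hη
  rcases mul_eq_zero.1 this with h | h
  · linarith
  · linarith

section RegProd

variable {n N : ℕ} (ℓ : Fin N → ((Fin n → ℂ) →ₗ[ℂ] ℂ)) (σ : Fin N → ℝ) (ε : ℝ)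

/-- The product of the regularized powers `(|ℓⱼ|² + ε) ^ σⱼ`. -/
noncomputable def regProd (x : Fin n → ℂ) : ℝ := ∏ j, (‖ℓ j x‖ ^ 2 + ε) ^ σ j

/-- The logarithmic derivative of `|ℓⱼ|² + ε` at `x` in direction `v`. -/
noncomputable def regSlope (j : Fin N) (x v : Fin n → ℂ) : ℝ :=
  2 * (ℓ j x * (starRingEnd ℂ) (ℓ j v)).re / (‖ℓ j x‖ ^ 2 + ε)

/-- The logarithmic derivative of `regProd` at `x` in direction `v`. -/
noncomputable def regProdSlope (x v : Fin n → ℂ) : ℝ := ∑ j, σ j * regSlope ℓ ε j x v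

/-- The second derivative of `regProd` at `x` in direction `v`. -/
noncomputable def regProdHess (x v : Fin n → ℂ) : ℝ :=
  regProd ℓ σ ε x * (regProdSlope ℓ σ ε x v ^ 2
    + ∑ j, σ j * (2 * ‖ℓ j v‖ ^ 2 / (‖ℓ j x‖ ^ 2 + ε) - regSlope ℓ ε j x v ^ 2))

variable {ℓ σ ε}

lemma regProd_nonneg (hε : 0 ≤ ε) (x : Fin n → ℂ) : 0 ≤ regProd ℓ σ ε x :=
  Finset.prod_nonneg fun j _ => by positivity

lemma regProd_eq_exp (hε : 0 < ε) (x : Fin n → ℂ) :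
    regProd ℓ σ ε x = Real.exp (∑ j, σ j * Real.log (‖ℓ j x‖ ^ 2 + ε)) := by
  rw [regProd, Real.exp_sum]
  refine Finset.prod_congr rfl fun j _ => ?_
  rw [Real.rpow_def_of_pos (by positivity), mul_comm]

lemma hasDerivAt_norm_sq_line (p q : ℂ) (t : ℝ) :
    HasDerivAt (fun t : ℝ => ‖p + t * q‖ ^ 2) (2 * ((p + t * q) * (starRingEnd ℂ) q).re) t := by
  have h : (fun t : ℝ => ‖p + t * q‖ ^ 2) = fun t : ℝ =>
      ‖p‖ ^ 2 + t * (2 * (p * (starRingEnd ℂ) q).re) + t ^ 2 * ‖q‖ ^ 2 := by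
    ext t
    simp only [Complex.sq_norm, Complex.normSq_apply]
    simp
    ring
  rw [h]
  have := (((hasDerivAt_id t).mul_const (2 * (p * (starRingEnd ℂ) q).re)).const_add
    (‖p‖ ^ 2)).add ((hasDerivAt_pow 2 t).mul_const (‖q‖ ^ 2))
  refine this.congr_deriv ?_
  simp only [Complex.sq_norm, Complex.normSq_apply]
  simp
  ring

lemma hasDerivAt_re_line (p q : ℂ) (t : ℝ) :
    HasDerivAt (fun t : ℝ => 2 * ((p + t * q) * (starRingEnd ℂ) q).re) (2 * ‖q‖ ^ 2) t := by
  have h : (fun t : ℝ => 2 * ((p + t * q) * (starRingEnd ℂ) q).re) = fun t : ℝ =>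
      2 * (p * (starRingEnd ℂ) q).re + t * (2 * ‖q‖ ^ 2) := by
    ext t
    simp only [Complex.sq_norm, Complex.normSq_apply]
    simp
    ring
  rw [h]
  simpa using ((hasDerivAt_id t).mul_const (2 * ‖q‖ ^ 2)).const_add
    (2 * (p * (starRingEnd ℂ) q).re)

lemma map_line (j : Fin N) (x v : Fin n → ℂ) (t : ℝ) :
    ℓ j (x + (t : ℂ) • v) = ℓ j x + t * ℓ j v := by
  rw [map_add, map_smul, smul_eq_mul]

lemma hasDerivAt_regProd (hε : 0 < ε) (x v : Fin n → ℂ) (t : ℝ) :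
    HasDerivAt (fun t : ℝ => regProd ℓ σ ε (x + (t : ℂ) • v))
      (regProd ℓ σ ε (x + (t : ℂ) • v) * regProdSlope ℓ σ ε (x + (t : ℂ) • v) v) t := by
  simp_rw [regProd_eq_exp hε, regProdSlope, regSlope, map_line]
  refine HasDerivAt.exp (HasDerivAt.fun_sum fun j _ => HasDerivAt.const_mul _ ?_)
  exact ((hasDerivAt_norm_sq_line _ _ t).add_const ε).log (by positivity)

lemma hasDerivAt_regProd_mul_slope (hε : 0 < ε) (x v : Fin n → ℂ) (t : ℝ) :
    HasDerivAt (fun t : ℝ => regProd ℓ σ ε (x + (t : ℂ) • v)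
        * regProdSlope ℓ σ ε (x + (t : ℂ) • v) v)
      (regProdHess ℓ σ ε (x + (t : ℂ) • v) v) t := by
  have h1 : HasDerivAt (fun t : ℝ => regProdSlope ℓ σ ε (x + (t : ℂ) • v) v)
      (∑ j, σ j * (2 * ‖ℓ j v‖ ^ 2 / (‖ℓ j (x + (t : ℂ) • v)‖ ^ 2 + ε)
        - regSlope ℓ ε j (x + (t : ℂ) • v) v ^ 2)) t := by
    simp_rw [regProdSlope, regSlope, map_line]
    refine HasDerivAt.fun_sum fun j _ => HasDerivAt.const_mul _ ?_
    have hpos : 0 < ‖ℓ j x + t * ℓ j v‖ ^ 2 + ε := by positivity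
    refine ((hasDerivAt_re_line (ℓ j x) (ℓ j v) t).div
      ((hasDerivAt_norm_sq_line (ℓ j x) (ℓ j v) t).add_const ε) hpos.ne').congr_deriv ?_
    field_simp
  refine ((hasDerivAt_regProd hε x v t).mul h1).congr_deriv ?_
  rw [regProdHess]
  ring

lemma regSlope_smul (j : Fin N) (c : ℂ) (x v : Fin n → ℂ) : regSlope ℓ ε j x (c • v) =
    2 * ((starRingEnd ℂ) c * (ℓ j x * (starRingEnd ℂ) (ℓ j v))).re / (‖ℓ j x‖ ^ 2 + ε) := by
  rw [regSlope, map_smul, smul_eq_mul, map_mul]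
  congr 3
  ring

lemma sum_rotations_re (z : ℂ) :
    ∑ k : Fin 4, ((starRingEnd ℂ) (Complex.I ^ (k : ℕ)) * z).re = 0 := by
  simp [Fin.sum_univ_four, pow_succ]

lemma sum_rotations_re_sq (z : ℂ) :
    ∑ k : Fin 4, ((starRingEnd ℂ) (Complex.I ^ (k : ℕ)) * z).re ^ 2 = 2 * ‖z‖ ^ 2 := by
  rw [Complex.sq_norm, Complex.normSq_apply]
  simp [Fin.sum_univ_four, pow_succ]
  ring

/-- The gradient of the logarithm of `regProd` at `x` in the holomorphic direction `v`. -/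
noncomputable def regProdGrad (ℓ : Fin N → ((Fin n → ℂ) →ₗ[ℂ] ℂ)) (σ : Fin N → ℝ) (ε : ℝ)
    (x : Fin n → ℂ) : (Fin n → ℂ) →ₗ[ℂ] ℂ :=
  ∑ j, ((σ j / (‖ℓ j x‖ ^ 2 + ε) : ℝ) * (starRingEnd ℂ) (ℓ j x)) • ℓ j

lemma regProdSlope_smul (c : ℂ) (x v : Fin n → ℂ) : regProdSlope ℓ σ ε x (c • v) =
    2 * ((starRingEnd ℂ) c * (starRingEnd ℂ) (regProdGrad ℓ σ ε x v)).re := by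
  simp only [regProdSlope, regSlope_smul, regProdGrad, LinearMap.sum_apply, LinearMap.smul_apply,
    smul_eq_mul, map_sum, map_mul, Complex.conj_conj, Complex.conj_ofReal, Finset.mul_sum,
    Complex.re_sum]
  refine Finset.sum_congr rfl fun j _ => ?_
  rw [show (starRingEnd ℂ) c * (((σ j / (‖ℓ j x‖ ^ 2 + ε) : ℝ) : ℂ) * ℓ j x * (starRingEnd ℂ) (ℓ j v))
    = ((σ j / (‖ℓ j x‖ ^ 2 + ε) : ℝ) : ℂ) * ((starRingEnd ℂ) c * (ℓ j x * (starRingEnd ℂ) (ℓ j v)))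
    by ring, Complex.re_ofReal_mul]
  ring

lemma sum_rotations_regProdSlope (x v : Fin n → ℂ) :
    ∑ k : Fin 4, regProdSlope ℓ σ ε x (Complex.I ^ (k : ℕ) • v) = 0 := by
  simp_rw [regProdSlope_smul, ← Finset.mul_sum, sum_rotations_re, mul_zero]

/-- Rotation turns the real Hessian into the complex one, f(|∂ log f|² + ∂∂̄ log f). With u = |ℓⱼ|²
+ ε, each logarithm contributes |ℓⱼ(v)|²/u - |ℓⱼ(x)|²|ℓⱼ(v)|²/u² = ε|ℓⱼ(v)|²/u², which is manifestly
nonnegative. -/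
lemma sum_rotations_regProdHess (hε : 0 < ε) (x v : Fin n → ℂ) :
    ∑ k : Fin 4, regProdHess ℓ σ ε x (Complex.I ^ (k : ℕ) • v) =
      8 * (regProd ℓ σ ε x * (‖regProdGrad ℓ σ ε x v‖ ^ 2
        + ∑ j, σ j * ε * ‖ℓ j v‖ ^ 2 / (‖ℓ j x‖ ^ 2 + ε) ^ 2)) := by
  have h1 : ∑ k : Fin 4, regProdSlope ℓ σ ε x (Complex.I ^ (k : ℕ) • v) ^ 2
      = 8 * ‖regProdGrad ℓ σ ε x v‖ ^ 2 := by
    simp_rw [regProdSlope_smul, mul_pow, ← Finset.mul_sum, sum_rotations_re_sq,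
      RCLike.norm_conj]
    ring
  have h2 : ∀ j, ∑ k : Fin 4, σ j * (2 * ‖ℓ j (Complex.I ^ (k : ℕ) • v)‖ ^ 2 / (‖ℓ j x‖ ^ 2 + ε)
      - regSlope ℓ ε j x (Complex.I ^ (k : ℕ) • v) ^ 2)
      = 8 * (σ j * ε * ‖ℓ j v‖ ^ 2 / (‖ℓ j x‖ ^ 2 + ε) ^ 2) := by
    intro j
    have hpos : 0 < ‖ℓ j x‖ ^ 2 + ε := by positivity
    simp_rw [regSlope_smul, ← Finset.mul_sum, Finset.sum_sub_distrib, div_pow, mul_pow,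
      ← Finset.sum_div, ← Finset.mul_sum, sum_rotations_re_sq, map_smul, smul_eq_mul, norm_mul,
      norm_pow, Complex.norm_I, one_pow, one_mul, RCLike.norm_conj]
    simp only [Finset.sum_const, Finset.card_univ, Fintype.card_fin, nsmul_eq_mul]
    push_cast
    field_simp
    ring
  simp_rw [regProdHess, ← Finset.mul_sum, Finset.sum_add_distrib, h1]
  rw [Finset.sum_comm]
  simp_rw [h2, ← Finset.mul_sum]
  ring

/-- Taylor's formula is applied to the sum over the four lines at once, because only the sum has
vanishing first derivative at 0; hence a single ξ. The factor 1/8 is 1/2 from Taylor times 1/4 from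
the mean. -/
lemma exists_rotAvg_regProd_sub (hε : 0 < ε) (x w : Fin n → ℂ) {t : ℝ} (ht : 0 < t) :
    ∃ ξ, 0 < ξ ∧ ξ < t ∧ rotAvg (regProd ℓ σ ε) x ((t : ℂ) • w) - regProd ℓ σ ε x =
      t ^ 2 / 8 * ∑ k : Fin 4, regProdHess ℓ σ ε (x + (ξ : ℂ) • (Complex.I ^ (k : ℕ) • w))
        (Complex.I ^ (k : ℕ) • w) := by
  obtain ⟨ξ, h0, h1, h⟩ := exists_eq_sq_div_two_mul
    (φ := fun t : ℝ => (∑ k : Fin 4, regProd ℓ σ ε (x + (t : ℂ) • (Complex.I ^ (k : ℕ) • w)))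
      - 4 * regProd ℓ σ ε x)
    (φ' := fun t : ℝ => ∑ k : Fin 4, regProd ℓ σ ε (x + (t : ℂ) • (Complex.I ^ (k : ℕ) • w))
      * regProdSlope ℓ σ ε (x + (t : ℂ) • (Complex.I ^ (k : ℕ) • w)) (Complex.I ^ (k : ℕ) • w))
    (φ'' := fun t : ℝ => ∑ k : Fin 4, regProdHess ℓ σ ε (x + (t : ℂ) • (Complex.I ^ (k : ℕ) • w))
      (Complex.I ^ (k : ℕ) • w))
    (fun t => (HasDerivAt.fun_sum fun (k : Fin 4) _ =>
      hasDerivAt_regProd hε x (Complex.I ^ (k : ℕ) • w) t).sub_const _)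
    (fun t => HasDerivAt.fun_sum fun (k : Fin 4) _ =>
      hasDerivAt_regProd_mul_slope hε x (Complex.I ^ (k : ℕ) • w) t)
    (by simp) (by simp [← Finset.mul_sum, sum_rotations_regProdSlope]) ht
  refine ⟨ξ, h0, h1, ?_⟩
  have e : rotAvg (regProd ℓ σ ε) x ((t : ℂ) • w)
      = (∑ k : Fin 4, regProd ℓ σ ε (x + (t : ℂ) • (Complex.I ^ (k : ℕ) • w))) / 4 := by
    simp only [rotAvg, smul_comm (t : ℂ)]
  rw [e]
  linarith

lemma continuous_regProd (hε : 0 < ε) : Continuous (regProd ℓ σ ε) := by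
  have cℓ := fun j => continuous_linear (ℓ j)
  refine continuous_finsetProd _ fun j _ => Continuous.rpow_const (by fun_prop) fun x => Or.inl ?_
  positivity

lemma continuous_regSlope (hε : 0 < ε) (j : Fin N) :
    Continuous fun p : (Fin n → ℂ) × (Fin n → ℂ) => regSlope ℓ ε j p.1 p.2 := by
  have cℓ := fun j => continuous_linear (ℓ j)
  refine Continuous.div ?_ (by fun_prop) fun p => by positivity
  exact continuous_const.mul (Complex.continuous_re.comp (by fun_prop))

lemma continuous_regProdHess (hε : 0 < ε) :
    Continuous fun p : (Fin n → ℂ) × (Fin n → ℂ) => regProdHess ℓ σ ε p.1 p.2 := by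
  have cℓ := fun j => continuous_linear (ℓ j)
  have c1 := continuous_regProd (ℓ := ℓ) (σ := σ) hε
  have c2 := continuous_regSlope (ℓ := ℓ) hε
  have c3 : ∀ j, Continuous fun p : (Fin n → ℂ) × (Fin n → ℂ) =>
      2 * ‖ℓ j p.2‖ ^ 2 / (‖ℓ j p.1‖ ^ 2 + ε) := fun j =>
    Continuous.div (by fun_prop) (by fun_prop) fun p => by positivity
  unfold regProdHess regProdSlope
  fun_prop

lemma polyBdd_regProd (hε : 0 ≤ ε) (hσ : ∀ j, 0 ≤ σ j) : PolyBdd (regProd ℓ σ ε) :=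
  PolyBdd.prod _ fun j _ => (((polyBdd_norm_linear (ℓ j)).pow 2).add (PolyBdd.const ε)).rpow
    (fun x => by positivity) (hσ j)

lemma polyBdd_regProdHess (hε : 0 < ε) (hσ : ∀ j, 0 ≤ σ j) :
    PolyBdd fun p : (Fin n → ℂ) × (Fin n → ℂ) => regProdHess ℓ σ ε p.1 p.2 := by
  have b1 : PolyBdd fun p : (Fin n → ℂ) × (Fin n → ℂ) => ‖p.1‖ :=
    PolyBdd.norm_of_le zero_le_one fun p => by rw [one_mul]; exact norm_fst_le p
  have b2 : PolyBdd fun p : (Fin n → ℂ) × (Fin n → ℂ) => ‖p.2‖ :=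
    PolyBdd.norm_of_le zero_le_one fun p => by rw [one_mul]; exact norm_snd_le p
  have b3 : ∀ j, PolyBdd fun p : (Fin n → ℂ) × (Fin n → ℂ) => ‖ℓ j p.2‖ ^ 2 := fun j =>
    ((polyBdd_norm_linear (ℓ j)).comp b2).pow 2
  have b4 : ∀ j, PolyBdd fun p : (Fin n → ℂ) × (Fin n → ℂ) => regSlope ℓ ε j p.1 p.2 := by
    intro j
    -- With a = |ℓⱼ(x)| and b = |ℓⱼ(v)|, 2ab ≤ a² + b² ≤ (1 + b²/ε)(a² + ε).
    refine ((PolyBdd.const 1).add ((b3 j).const_mul ε⁻¹)).mono fun p => ?_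
    have hpos : 0 < ‖ℓ j p.1‖ ^ 2 + ε := by positivity
    have e : |1 + ε⁻¹ * ‖ℓ j p.2‖ ^ 2| = 1 + ε⁻¹ * ‖ℓ j p.2‖ ^ 2 := abs_of_nonneg (by positivity)
    rw [e, regSlope, abs_div, abs_of_pos hpos, div_le_iff₀ hpos, abs_mul, abs_two]
    have h1 : |(ℓ j p.1 * (starRingEnd ℂ) (ℓ j p.2)).re| ≤ ‖ℓ j p.1‖ * ‖ℓ j p.2‖ := by
      refine (Complex.abs_re_le_norm _).trans ?_
      simp
    have h2 : ε⁻¹ * ‖ℓ j p.2‖ ^ 2 * ε = ‖ℓ j p.2‖ ^ 2 := by field_simp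
    have h3 : 0 ≤ ε⁻¹ * ‖ℓ j p.2‖ ^ 2 * ‖ℓ j p.1‖ ^ 2 := by positivity
    nlinarith [sq_nonneg (‖ℓ j p.1‖ - ‖ℓ j p.2‖)]
  have b5 : ∀ j, PolyBdd fun p : (Fin n → ℂ) × (Fin n → ℂ) =>
      2 * ‖ℓ j p.2‖ ^ 2 / (‖ℓ j p.1‖ ^ 2 + ε) := by
    intro j
    refine ((b3 j).const_mul (2 / ε)).mono fun p => ?_
    rw [abs_of_nonneg (by positivity), abs_of_nonneg (by positivity), div_mul_eq_mul_div]
    gcongr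
    simp
  unfold regProdHess regProdSlope
  exact ((polyBdd_regProd hε.le hσ).comp b1).mul (((PolyBdd.sum _ fun j _ =>
    (b4 j).const_mul _).pow 2).add (PolyBdd.sum _ fun j _ =>
      ((b5 j).sub ((b4 j).pow 2)).const_mul _))

lemma abs_rotAvg_regProd_sub_le (hε : 0 < ε) (hσ : ∀ j, 0 ≤ σ j) :
    ∃ (C : ℝ) (K : ℕ), 0 ≤ C ∧ ∀ t : ℝ, 0 < t → t ≤ 1 → ∀ x w,
      |rotAvg (regProd ℓ σ ε) x ((t : ℂ) • w) - regProd ℓ σ ε x|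
        ≤ C * t ^ 2 * (1 + ‖x‖ + ‖w‖) ^ K := by
  obtain ⟨C, K, hC, hb⟩ := polyBdd_regProdHess (ℓ := ℓ) hε hσ
  refine ⟨C, K, hC, fun t ht ht1 x w => ?_⟩
  obtain ⟨ξ, hξ0, hξt, h⟩ := exists_rotAvg_regProd_sub (ℓ := ℓ) (σ := σ) hε x w ht
  have hk : ∀ k : Fin 4, |regProdHess ℓ σ ε (x + (ξ : ℂ) • (Complex.I ^ (k : ℕ) • w))
      (Complex.I ^ (k : ℕ) • w)| ≤ C * (1 + ‖x‖ + ‖w‖) ^ K := by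
    intro k
    have hw := norm_nonneg w
    have hIw : ‖Complex.I ^ (k : ℕ) • w‖ = ‖w‖ := by simp [norm_smul]
    have hle : ‖(x + (ξ : ℂ) • (Complex.I ^ (k : ℕ) • w), Complex.I ^ (k : ℕ) • w)‖
        ≤ ‖x‖ + ‖w‖ := by
      refine norm_prod_le_iff.2 ⟨(norm_add_le _ _).trans ?_, ?_⟩
      · rw [norm_smul, hIw, Complex.norm_real, Real.norm_of_nonneg hξ0.le]
        have := mul_le_of_le_one_left hw (hξt.le.trans ht1)
        linarith
      · simp only [hIw]
        linarith [norm_nonneg x]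
    refine (hb (x + (ξ : ℂ) • (Complex.I ^ (k : ℕ) • w), Complex.I ^ (k : ℕ) • w)).trans ?_
    rw [add_assoc]
    gcongr
  rw [h, abs_mul, abs_of_nonneg (by positivity)]
  have hs := (Finset.abs_sum_le_sum_abs (fun k : Fin 4 =>
    regProdHess ℓ σ ε (x + (ξ : ℂ) • (Complex.I ^ (k : ℕ) • w)) (Complex.I ^ (k : ℕ) • w))
    Finset.univ).trans (Finset.sum_le_sum fun k _ => hk k)
  simp only [Finset.sum_const, Finset.card_univ, Fintype.card_fin, nsmul_eq_mul] at hs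
  push_cast at hs
  have hp : 0 ≤ C * (1 + ‖x‖ + ‖w‖) ^ K := by positivity
  calc _ ≤ t ^ 2 / 8 * (4 * (C * (1 + ‖x‖ + ‖w‖) ^ K)) := by gcongr
    _ ≤ _ := by nlinarith [mul_nonneg (sq_nonneg t) hp]

lemma tendsto_rotAvg_regProd (hε : 0 < ε) (x₀ w : Fin n → ℂ) {x : ℝ → Fin n → ℂ}
    (hx : Tendsto x (𝓝[>] 0) (𝓝 x₀)) :
    Tendsto (fun t : ℝ => (rotAvg (regProd ℓ σ ε) (x t) ((t : ℂ) • w) - regProd ℓ σ ε (x t)) / t ^ 2)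
      (𝓝[>] 0) (𝓝 (1 / 8 * ∑ k : Fin 4, regProdHess ℓ σ ε x₀ (Complex.I ^ (k : ℕ) • w))) := by
  -- The intermediate point is chosen for every t, arbitrarily when t ≤ 0; being squeezed between 0
  -- and t, it tends to 0, and continuity of the Hessian gives the limit.
  have hex : ∀ t : ℝ, ∃ ξ, 0 < t → 0 < ξ ∧ ξ < t ∧
      rotAvg (regProd ℓ σ ε) (x t) ((t : ℂ) • w) - regProd ℓ σ ε (x t) =
      t ^ 2 / 8 * ∑ k : Fin 4, regProdHess ℓ σ ε (x t + (ξ : ℂ) • (Complex.I ^ (k : ℕ) • w))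
      (Complex.I ^ (k : ℕ) • w) := by
    intro t
    by_cases ht : 0 < t
    · obtain ⟨ξ, h⟩ := exists_rotAvg_regProd_sub (ℓ := ℓ) (σ := σ) hε (x t) w ht
      exact ⟨ξ, fun _ => h⟩
    · exact ⟨0, fun h => absurd h ht⟩
  choose ξ hξ using hex
  have hξ0 : Tendsto ξ (𝓝[>] 0) (𝓝 0) := by
    refine tendsto_of_tendsto_of_tendsto_of_le_of_le' tendsto_const_nhds
      (tendsto_nhdsWithin_of_tendsto_nhds tendsto_id) ?_ ?_
    · filter_upwards [self_mem_nhdsWithin] with t ht using (hξ t ht).1.le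
    · filter_upwards [self_mem_nhdsWithin] with t ht using (hξ t ht).2.1.le
  have hlim : Tendsto (fun t => 1 / 8 * ∑ k : Fin 4,
      regProdHess ℓ σ ε (x t + (ξ t : ℂ) • (Complex.I ^ (k : ℕ) • w)) (Complex.I ^ (k : ℕ) • w))
      (𝓝[>] 0) (𝓝 (1 / 8 * ∑ k : Fin 4, regProdHess ℓ σ ε x₀ (Complex.I ^ (k : ℕ) • w))) := by
    refine Tendsto.const_mul _ (tendsto_finsetSum _ fun k _ => ?_)
    have hc : Continuous fun p : (Fin n → ℂ) × ℝ => regProdHess ℓ σ ε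
        (p.1 + (p.2 : ℂ) • (Complex.I ^ (k : ℕ) • w)) (Complex.I ^ (k : ℕ) • w) :=
      (continuous_regProdHess hε).comp (f := fun p : (Fin n → ℂ) × ℝ =>
        (p.1 + (p.2 : ℂ) • (Complex.I ^ (k : ℕ) • w), Complex.I ^ (k : ℕ) • w)) (by fun_prop)
    have h1 := (hc.tendsto (x₀, 0)).comp (hx.prodMk_nhds hξ0)
    simp only [Complex.ofReal_zero, zero_smul, add_zero] at h1
    exact h1
  refine hlim.congr' ?_
  filter_upwards [self_mem_nhdsWithin] with t ht
  have ht0 : t ≠ 0 := (Set.mem_Ioi.1 ht).ne'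
  rw [(hξ t ht).2.2, eq_div_iff (pow_ne_zero 2 ht0)]
  ring

theorem smoothPSH_regProd (hε : 0 < ε) (hσ : ∀ j, 0 ≤ σ j) : SmoothPSH (regProd ℓ σ ε) where
  cont := continuous_regProd hε
  poly := polyBdd_regProd hε.le hσ
  bound := abs_rotAvg_regProd_sub_le hε hσ
  levi := by
    intro x₀
    -- One form for |∂ log f|² and one for each ∂∂̄ log(|ℓⱼ|² + ε), scaled by the square roots of
    -- their nonnegative coefficients.
    refine ⟨N + 1, Fin.cons (((√(regProd ℓ σ ε x₀) : ℝ) : ℂ) • regProdGrad ℓ σ ε x₀)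
      fun j => ((√(regProd ℓ σ ε x₀ * (σ j * ε)) / (‖ℓ j x₀‖ ^ 2 + ε) : ℝ) : ℂ) • ℓ j, ?_⟩
    intro w x hx
    have hval : ∑ i, ‖(Fin.cons (((√(regProd ℓ σ ε x₀) : ℝ) : ℂ) • regProdGrad ℓ σ ε x₀)
        (fun j => ((√(regProd ℓ σ ε x₀ * (σ j * ε)) / (‖ℓ j x₀‖ ^ 2 + ε) : ℝ) : ℂ) • ℓ j) :
          Fin (N + 1) → ((Fin n → ℂ) →ₗ[ℂ] ℂ)) i w‖ ^ 2 =
        1 / 8 * ∑ k : Fin 4, regProdHess ℓ σ ε x₀ (Complex.I ^ (k : ℕ) • w) := by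
      rw [sum_rotations_regProdHess hε, Fin.sum_univ_succ]
      have hf := regProd_nonneg (ℓ := ℓ) (σ := σ) hε.le x₀
      simp only [Fin.cons_zero, Fin.cons_succ, LinearMap.smul_apply, smul_eq_mul, norm_mul,
        Complex.norm_real, mul_pow, Real.norm_eq_abs, sq_abs, div_pow, Real.sq_sqrt hf]
      rw [mul_add, mul_add, Finset.mul_sum, mul_add, Finset.mul_sum, Finset.mul_sum]
      congr 1
      · ring
      · refine Finset.sum_congr rfl fun j _ => ?_
        rw [Real.sq_sqrt (mul_nonneg hf (mul_nonneg (hσ j) hε.le))]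
        ring
    rw [hval]
    exact tendsto_rotAvg_regProd hε x₀ w hx

lemma regProd_smul (c : ℂ) (hc : ‖c‖ = 1) (x : Fin n → ℂ) :
    regProd ℓ σ ε (c • x) = regProd ℓ σ ε x := by
  simp [regProd, hc]

end RegProd

end

/-! ### Removal of the regularization -/

section

open Filter Topology

section Limit

variable {n N : ℕ} {ℓ : Fin N → ((Fin n → ℂ) →ₗ[ℂ] ℂ)} {σ σ' : Fin N → ℝ}

lemma continuous_regProd_of_nonneg (ε : ℝ) (hσ : ∀ j, 0 ≤ σ j) : Continuous (regProd ℓ σ ε) := by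
  have cℓ := fun j => continuous_linear (ℓ j)
  exact continuous_finsetProd _ fun j _ =>
    Continuous.rpow_const (by fun_prop) fun x => Or.inr (hσ j)

/-- Since the exponents are nonnegative, the integrand increases with ε, so its value at ε = 1
dominates for ε < 1. -/
lemma tendsto_integral_regProd (hσ : ∀ j, 0 ≤ σ j) :
    Tendsto (fun ε : ℝ => ∫ x, regProd ℓ σ ε x ∂(stdComplexGaussian n)) (𝓝[>] 0)
      (𝓝 (∫ x, regProd ℓ σ 0 x ∂(stdComplexGaussian n))) := by
  refine tendsto_integral_filter_of_dominated_convergence (regProd ℓ σ 1) ?_ ?_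
    ((polyBdd_regProd zero_le_one hσ).integrable_stdComplexGaussian
      (continuous_regProd_of_nonneg 1 hσ)) ?_
  · exact Eventually.of_forall fun ε =>
      (continuous_regProd_of_nonneg ε hσ).aestronglyMeasurable
  · filter_upwards [self_mem_nhdsWithin, nhdsWithin_le_nhds (eventually_lt_nhds one_pos)]
      with ε hε hε1
    have hε0 : 0 ≤ ε := (Set.mem_Ioi.1 hε).le
    refine Eventually.of_forall fun x => ?_
    rw [Real.norm_of_nonneg (regProd_nonneg hε0 x)]
    refine Finset.prod_le_prod (fun j _ => by positivity) fun j _ => ?_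
    have := hσ j
    gcongr
  · refine Eventually.of_forall fun x => ?_
    have : Continuous fun ε : ℝ => regProd ℓ σ ε x := continuous_finsetProd _ fun j _ =>
      Continuous.rpow_const (by fun_prop) fun _ => Or.inr (hσ j)
    exact (this.tendsto 0).mono_left nhdsWithin_le_nhds

lemma regProd_mul_regProd {ε : ℝ} (hε : 0 ≤ ε) (hσ : ∀ j, 0 ≤ σ j) (hσ' : ∀ j, 0 ≤ σ' j)
    (x : Fin n → ℂ) : regProd ℓ σ ε x * regProd ℓ σ' ε x = regProd ℓ (σ + σ') ε x := by
  rw [regProd, regProd, regProd, ← Finset.prod_mul_distrib]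
  refine Finset.prod_congr rfl fun j _ => ?_
  rw [Pi.add_apply, Real.rpow_add_of_nonneg (by positivity) (hσ j) (hσ' j)]

theorem integral_regProd_mul_le (hσ : ∀ j, 0 ≤ σ j) (hσ' : ∀ j, 0 ≤ σ' j) :
    (∫ x, regProd ℓ σ 0 x ∂(stdComplexGaussian n)) * (∫ x, regProd ℓ σ' 0 x ∂(stdComplexGaussian n))
      ≤ ∫ x, regProd ℓ (σ + σ') 0 x ∂(stdComplexGaussian n) := by
  refine le_of_tendsto_of_tendsto
    ((tendsto_integral_regProd hσ).mul (tendsto_integral_regProd hσ'))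
    (tendsto_integral_regProd fun j => add_nonneg (hσ j) (hσ' j)) ?_
  filter_upwards [self_mem_nhdsWithin] with ε hε
  have hε : 0 < ε := hε
  simp_rw [← regProd_mul_regProd hε.le hσ hσ']
  exact (smoothPSH_regProd hε hσ).integral_mul_ge (smoothPSH_regProd hε hσ')
    fun c x hc => regProd_smul c hc x

/-- Exponent 0 off S lets one family of forms serve every subset of coordinates, so disjoint unions
become sums of exponents. The halving compensates the squared modulus in the base. -/
lemma regProd_zero_eq (α : Fin N → ℝ) (S : Finset (Fin N)) (x : Fin n → ℂ) :
    regProd ℓ (fun j => if j ∈ S then α j / 2 else 0) 0 x = ∏ j ∈ S, ‖ℓ j x‖ ^ α j := by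
  rw [regProd, ← Finset.prod_subset (Finset.subset_univ S)
    (fun j _ hj => by rw [if_neg hj, Real.rpow_zero])]
  refine Finset.prod_congr rfl fun j hj => ?_
  rw [if_pos hj, add_zero, ← Real.rpow_natCast, ← Real.rpow_mul (norm_nonneg _)]
  congr 1
  push_cast
  ring

end Limit

/-! ### Moments of a single linear form -/

section LinearForm

/-- A complex linear form of a standard complex Gaussian vector is a multiple of a standard
complex Gaussian variable. -/
lemma map_linear_stdComplexGaussian {n : ℕ} (ℓ : (Fin n → ℂ) →ₗ[ℂ] ℂ) :
    (stdComplexGaussian n).map ℓ = complexGaussian.map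
      fun z => ((√(∑ j, ‖ℓ (Pi.single j 1)‖ ^ 2) : ℝ) : ℂ) * z := by
  set v : ℝ := √(∑ j, ‖ℓ (Pi.single j 1)‖ ^ 2) with hv
  have hv2 : v ^ 2 = ∑ j, ‖ℓ (Pi.single j 1)‖ ^ 2 := Real.sq_sqrt (by positivity)
  let T : (Fin n → ℂ) →L[ℝ] ℂ := (LinearMap.toContinuousLinearMap ℓ).restrictScalars ℝ
  let V : ℂ →L[ℝ] ℂ := v • ContinuousLinearMap.id ℝ ℂ
  have hT : (ℓ : (Fin n → ℂ) → ℂ) = T := rfl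
  have hV : (fun z : ℂ => (v : ℂ) * z) = V := by
    ext z
    simp [V]
  have := Measure.isProbabilityMeasure_map (μ := stdComplexGaussian n)
    (continuous_linear ℓ).measurable.aemeasurable
  have : IsProbabilityMeasure (complexGaussian.map fun z => (v : ℂ) * z) :=
    Measure.isProbabilityMeasure_map (by fun_prop)
  refine Measure.ext_of_charFunDual (funext fun L => ?_)
  -- Multiplication by a is a similarity of the real plane, so the characteristic function of ℓ
  -- depends only on ∑ |ℓ(eⱼ)|².
  have key : ∀ a : ℂ, L a ^ 2 + L (Complex.I * a) ^ 2 = ‖a‖ ^ 2 * (L 1 ^ 2 + L Complex.I ^ 2) := by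
    intro a
    have e1 : L a = a.re * L 1 + a.im * L Complex.I := by
      rw [← smul_eq_mul, ← smul_eq_mul, ← map_smul, ← map_smul, ← map_add]
      congr 1
      simp [Complex.re_add_im]
    have e2 : L (Complex.I * a) = -a.im * L 1 + a.re * L Complex.I := by
      rw [← smul_eq_mul (-a.im), ← smul_eq_mul a.re, ← map_smul, ← map_smul, ← map_add]
      congr 1
      simp [Complex.ext_iff]
    rw [e1, e2, Complex.sq_norm, Complex.normSq_apply]
    ring
  rw [hT, hV, charFunDual_map, charFunDual_map, charFunDual_stdComplexGaussian,
    charFunDual_complexGaussian]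
  have h1 : ∀ j, (L.comp T) (Pi.single j Complex.I) = L (Complex.I * ℓ (Pi.single j 1)) := by
    intro j
    rw [← smul_eq_mul, ← map_smul, ← Pi.single_smul, smul_eq_mul, mul_one]
    rfl
  have h2 : ∀ j, (L.comp T) (Pi.single j 1) = L (ℓ (Pi.single j 1)) := fun j => rfl
  have h3 : ∀ z, (L.comp V) z = v * L z := fun z => by simp [V]
  simp_rw [h1, h2, h3, key, ← Finset.sum_mul, ← hv2]
  congr 4
  ring

lemma integral_norm_rpow_linear {n : ℕ} (ℓ : (Fin n → ℂ) →ₗ[ℂ] ℂ) {α : ℝ} (hα : 0 ≤ α) :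
    ∫ x, ‖ℓ x‖ ^ α ∂(stdComplexGaussian n) = (√(∑ j, ‖ℓ (Pi.single j 1)‖ ^ 2)) ^ α
      * ∫ z, ‖z‖ ^ α ∂complexGaussian := by
  have hc : Continuous fun z : ℂ => ‖z‖ ^ α := continuous_norm.rpow_const fun _ => Or.inr hα
  have h := congrArg (fun ν : Measure ℂ => ∫ z, ‖z‖ ^ α ∂ν) (map_linear_stdComplexGaussian ℓ)
  rw [integral_map (continuous_linear ℓ).measurable.aemeasurable hc.aestronglyMeasurable,
    integral_map (by fun_prop) hc.aestronglyMeasurable] at h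
  rw [h, ← integral_const_mul]
  congr 1; ext z
  rw [norm_mul, Complex.norm_real, Real.norm_of_nonneg (Real.sqrt_nonneg _),
    Real.mul_rpow (Real.sqrt_nonneg _) (norm_nonneg _)]

/-- The scale of the one-dimensional law is read off from the second moment, because E|z|² = 1.
Coordinates with equal variance thus have equal moments of every order α ≥ 0. -/
lemma integral_norm_rpow_linear_eq {n : ℕ} (ℓ : (Fin n → ℂ) →ₗ[ℂ] ℂ) {α : ℝ} (hα : 0 ≤ α) :
    ∫ x, ‖ℓ x‖ ^ α ∂(stdComplexGaussian n) =
      (∫ x, ‖ℓ x‖ ^ 2 ∂(stdComplexGaussian n)) ^ (α / 2) * ∫ z, ‖z‖ ^ α ∂complexGaussian := by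
  have h2 := integral_norm_rpow_linear ℓ (α := 2) (by norm_num)
  simp only [Real.rpow_two] at h2
  rw [integral_norm_rpow_linear ℓ hα, h2, integral_norm_sq_complexGaussian, mul_one,
    ← Real.rpow_natCast, ← Real.rpow_mul (Real.sqrt_nonneg _)]
  congr 2
  push_cast
  ring

end LinearForm

/-! ### Gaussian vectors on a probability space and the comparison with independence -/

section Transfer

variable {Ω : Type*} [MeasurableSpace Ω] {P : Measure Ω} {N n : ℕ} {X : Ω → Fin N → ℂ}
  {G : Ω → Fin n → ℂ} {A : (Fin n → ℂ) →ₗ[ℂ] (Fin N → ℂ)}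

lemma integral_comp_gaussian {F : (Fin N → ℂ) → ℝ} (hF : Continuous F)
    (hG : HasLaw G (stdComplexGaussian n) P) (hX : ∀ᵐ ω ∂P, X ω = A (G ω)) :
    ∫ ω, F (X ω) ∂P = ∫ x, F (A x) ∂(stdComplexGaussian n) := by
  have hA : Continuous A := (LinearMap.toContinuousLinearMap A).continuous
  rw [← hG.map_eq,
    integral_map (f := fun x => F (A x)) hG.aemeasurable (hF.comp hA).aestronglyMeasurable]
  exact integral_congr_ae (hX.mono fun ω h => by simp only [h])

lemma continuous_prod_norm_rpow {α : Fin N → ℝ} (hα : ∀ j, 0 ≤ α j) (S : Finset (Fin N)) :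
    Continuous fun x : Fin N → ℂ => ∏ j ∈ S, ‖x j‖ ^ α j :=
  continuous_finsetProd _ fun j _ =>
    (continuous_apply j).norm.rpow_const fun _ => Or.inr (hα j)

lemma integral_prod_norm_rpow {α : Fin N → ℝ} (hα : ∀ j, 0 ≤ α j) (S : Finset (Fin N))
    (hG : HasLaw G (stdComplexGaussian n) P) (hX : ∀ᵐ ω ∂P, X ω = A (G ω)) :
    ∫ ω, ∏ j ∈ S, ‖X ω j‖ ^ α j ∂P =
      ∫ x, regProd (fun j => LinearMap.proj j ∘ₗ A) (fun j => if j ∈ S then α j / 2 else 0) 0 x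
        ∂(stdComplexGaussian n) := by
  rw [integral_comp_gaussian (continuous_prod_norm_rpow hα S) hG hX]
  simp_rw [regProd_zero_eq]
  rfl

lemma integrable_prod_norm_rpow {α : Fin N → ℝ} (hα : ∀ j, 0 ≤ α j) (S : Finset (Fin N))
    (hG : HasLaw G (stdComplexGaussian n) P) (hX : ∀ᵐ ω ∂P, X ω = A (G ω)) :
    Integrable (fun ω => ∏ j ∈ S, ‖X ω j‖ ^ α j) P := by
  have hσ : ∀ j, 0 ≤ (fun j => if j ∈ S then α j / 2 else 0) j := fun j => by
    have := hα j
    simp only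
    split_ifs <;> positivity
  have h := (polyBdd_regProd (ℓ := fun j => LinearMap.proj j ∘ₗ A) le_rfl
    hσ).integrable_stdComplexGaussian (continuous_regProd_of_nonneg 0 hσ)
  rw [← hG.map_eq, integrable_map_measure
    (continuous_regProd_of_nonneg 0 hσ).aestronglyMeasurable hG.aemeasurable] at h
  refine h.congr (hX.mono fun ω hω => ?_)
  rw [Function.comp_apply, regProd_zero_eq]
  change _ = ∏ j ∈ S, ‖X ω j‖ ^ α j
  rw [hω]
  rfl

lemma aemeasurable_coord (hG : HasLaw G (stdComplexGaussian n) P)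
    (hX : ∀ᵐ ω ∂P, X ω = A (G ω)) (j : Fin N) : AEMeasurable (fun ω => X ω j) P := by
  have hA : Continuous A := (LinearMap.toContinuousLinearMap A).continuous
  refine AEMeasurable.congr ?_ (hX.mono fun ω h => (congrFun h j).symm)
  exact ((continuous_apply j).comp hA).measurable.comp_aemeasurable hG.aemeasurable

end Transfer

variable {Ω : Type*} [MeasurableSpace Ω] {P : Measure Ω} {N : ℕ} {X : Ω → Fin N → ℂ}

/-- Complex Gaussian product inequality for the moments over two disjoint sets of coordinates. -/
theorem IsCenteredComplexGaussian.integral_mul_le (hX : IsCenteredComplexGaussian X P)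
    {α : Fin N → ℝ} (hα : ∀ j, 0 ≤ α j) {S T : Finset (Fin N)} (hST : Disjoint S T) :
    (∫ ω, ∏ j ∈ S, ‖X ω j‖ ^ α j ∂P) * (∫ ω, ∏ j ∈ T, ‖X ω j‖ ^ α j ∂P) ≤
      ∫ ω, ∏ j ∈ S ∪ T, ‖X ω j‖ ^ α j ∂P := by
  obtain ⟨n, G, A, hG, hXA⟩ := hX
  have hσ : ∀ (S : Finset (Fin N)) j, 0 ≤ (fun j => if j ∈ S then α j / 2 else 0) j :=
    fun S j => by
      have := hα j
      simp only
      split_ifs <;> positivity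
  rw [integral_prod_norm_rpow hα S hG hXA, integral_prod_norm_rpow hα T hG hXA,
    integral_prod_norm_rpow hα (S ∪ T) hG hXA]
  have hadd : ((fun j => if j ∈ S then α j / 2 else 0) + fun j => if j ∈ T then α j / 2 else 0) =
      fun j => if j ∈ S ∪ T then α j / 2 else 0 := by
    ext j
    have : j ∈ S → j ∉ T := fun h => Finset.disjoint_left.1 hST h
    by_cases h1 : j ∈ S <;> by_cases h2 : j ∈ T <;> simp_all
  rw [← hadd]
  exact integral_regProd_mul_le (hσ S) (hσ T)

theorem IsCenteredComplexGaussian.prod_integral_le [IsProbabilityMeasure P]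
    (hX : IsCenteredComplexGaussian X P)
    {α : Fin N → ℝ} (hα : ∀ j, 0 ≤ α j) (S : Finset (Fin N)) :
    ∏ j ∈ S, ∫ ω, ‖X ω j‖ ^ α j ∂P ≤ ∫ ω, ∏ j ∈ S, ‖X ω j‖ ^ α j ∂P := by
  induction S using Finset.induction_on with
  | empty => simp
  | insert a S ha ih =>
    rw [Finset.prod_insert ha, Finset.insert_eq]
    refine le_trans ?_ (hX.integral_mul_le hα (Finset.disjoint_singleton_left.2 ha))
    simp_rw [Finset.prod_singleton]
    exact mul_le_mul_of_nonneg_left ih (integral_nonneg fun ω => by positivity)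

theorem IsCenteredComplexGaussian.integral_norm_rpow (hX : IsCenteredComplexGaussian X P)
    {α : ℝ} (hα : 0 ≤ α) (j : Fin N) :
    ∫ ω, ‖X ω j‖ ^ α ∂P =
      (∫ ω, ‖X ω j‖ ^ 2 ∂P) ^ (α / 2) * ∫ z, ‖z‖ ^ α ∂complexGaussian := by
  obtain ⟨n, G, A, hG, hXA⟩ := hX
  rw [integral_comp_gaussian (F := fun x => ‖x j‖ ^ α)
      ((continuous_apply j).norm.rpow_const fun _ => Or.inr hα) hG hXA,
    integral_comp_gaussian (F := fun x => ‖x j‖ ^ 2) (by fun_prop) hG hXA]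
  exact integral_norm_rpow_linear_eq (LinearMap.proj j ∘ₗ A) hα

theorem IsCenteredComplexGaussian.integral_prod_of_iIndepFun (hX : IsCenteredComplexGaussian X P)
    (hi : iIndepFun (fun j ω => X ω j) P) {α : Fin N → ℝ} (hα : ∀ j, 0 ≤ α j) :
    ∫ ω, ∏ j, ‖X ω j‖ ^ α j ∂P = ∏ j, ∫ ω, ‖X ω j‖ ^ α j ∂P := by
  obtain ⟨n, G, A, hG, hXA⟩ := hX
  exact hi.integral_fun_prod_comp (f := fun j z => ‖z‖ ^ α j)
    (fun j => aemeasurable_coord hG hXA j)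
    fun j => (continuous_norm.rpow_const fun _ => Or.inr (hα j)).aestronglyMeasurable

/-- Centered complex Gaussian vectors with independent coordinates and given variances exist. -/
theorem exists_independent_complexGaussian {N : ℕ} (v : Fin N → ℝ) (hv : ∀ j, 0 ≤ v j) :
    ∃ Y : (Fin N → ℂ) → Fin N → ℂ, IsCenteredComplexGaussian Y (stdComplexGaussian N) ∧
      iIndepFun (fun j ω => Y ω j) (stdComplexGaussian N) ∧
      ∀ j, ∫ ω, ‖Y ω j‖ ^ 2 ∂(stdComplexGaussian N) = v j := by
  refine ⟨fun ω j => ((√(v j) : ℝ) : ℂ) * ω j, ⟨N, id,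
    LinearMap.pi fun j => ((√(v j) : ℝ) : ℂ) • LinearMap.proj j, HasLaw.id, ?_⟩, ?_, fun j => ?_⟩
  · refine Eventually.of_forall fun ω => ?_
    ext j
    simp
  · rw [stdComplexGaussian_eq_pi]
    exact iIndepFun_pi (X := fun (j : Fin N) (z : ℂ) => ((√(v j) : ℝ) : ℂ) * z)
      fun j => by fun_prop
  · rw [stdComplexGaussian_eq_pi, integral_comp_eval (μ := fun _ : Fin N => complexGaussian)
      (i := j) (f := fun z => ‖((√(v j) : ℝ) : ℂ) * z‖ ^ 2)
      (Continuous.aestronglyMeasurable (by fun_prop))]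
    simp_rw [norm_mul, mul_pow, Complex.norm_real, Real.norm_eq_abs, sq_abs, Real.sq_sqrt (hv j)]
    rw [integral_const_mul, integral_norm_sq_complexGaussian, mul_one]

end

theorem theorem3 {Ω : Type*} [MeasurableSpace Ω] (P : Measure Ω) [IsProbabilityMeasure P]
    (N : ℕ) (X : Ω → Fin N → ℂ) (hX : IsCenteredComplexGaussian X P)
    (α : Fin N → ℝ) (hα : ∀ j, 0 ≤ α j) :
    -- all the moments below are finite
    (∀ S : Finset (Fin N), Integrable (fun ω => ∏ j ∈ S, ‖X ω j‖ ^ α j) P) ∧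
    -- correlation inequality for the first `k` and the remaining coordinates
    (∀ k : ℕ, k < N →
      (∫ ω, ∏ j ∈ Finset.univ.filter (fun j : Fin N => (j : ℕ) < k), ‖X ω j‖ ^ α j ∂P) *
          (∫ ω, ∏ j ∈ Finset.univ.filter (fun j : Fin N => k ≤ (j : ℕ)), ‖X ω j‖ ^ α j ∂P) ≤
        ∫ ω, ∏ j : Fin N, ‖X ω j‖ ^ α j ∂P) ∧
    -- comparison with the product of the individual moments
    (∏ j : Fin N, ∫ ω, ‖X ω j‖ ^ α j ∂P) ≤ ∫ ω, ∏ j : Fin N, ‖X ω j‖ ^ α j ∂P ∧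
    -- among centered complex Gaussian vectors with the same `E |X_j|²`, those with independent
    -- coordinates have the smallest moment ...
    (∀ {Ω' : Type*} [MeasurableSpace Ω'] (P' : Measure Ω') [IsProbabilityMeasure P']
      (Y : Ω' → Fin N → ℂ), IsCenteredComplexGaussian Y P' →
      iIndepFun (fun j ω => Y ω j) P' →
      (∀ j, ∫ ω, ‖Y ω j‖ ^ 2 ∂P' = ∫ ω, ‖X ω j‖ ^ 2 ∂P) →
      ∫ ω, ∏ j : Fin N, ‖Y ω j‖ ^ α j ∂P' ≤ ∫ ω, ∏ j : Fin N, ‖X ω j‖ ^ α j ∂P) ∧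
    -- ... and such a vector exists, so that the minimum is attained
    (∃ (Ω' : Type) (_ : MeasurableSpace Ω') (P' : Measure Ω') (_ : IsProbabilityMeasure P')
      (Y : Ω' → Fin N → ℂ), IsCenteredComplexGaussian Y P' ∧
      iIndepFun (fun j ω => Y ω j) P' ∧
      ∀ j, ∫ ω, ‖Y ω j‖ ^ 2 ∂P' = ∫ ω, ‖X ω j‖ ^ 2 ∂P) := by
  refine ⟨?_, ?_, hX.prod_integral_le hα Finset.univ, ?_, ?_⟩
  · obtain ⟨n, G, A, hG, hXA⟩ := hX
    exact fun S => integrable_prod_norm_rpow hα S hG hXA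
  · intro k _
    have h := hX.integral_mul_le hα (S := Finset.univ.filter fun j : Fin N => (j : ℕ) < k)
      (T := Finset.univ.filter fun j : Fin N => k ≤ (j : ℕ))
      (Finset.disjoint_filter.2 fun j _ h1 h2 => absurd h1 (not_lt.2 h2))
    have hu : (Finset.univ.filter fun j : Fin N => (j : ℕ) < k) ∪
        (Finset.univ.filter fun j : Fin N => k ≤ (j : ℕ)) = Finset.univ := by
      ext j
      simp [lt_or_ge]
    rwa [hu] at h
  · intro Ω' _ P' _ Y hY hi hvar
    -- Independence turns the moment of Y into the product of its individual moments; equal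
    -- variances identify these with the moments of X.
    rw [hY.integral_prod_of_iIndepFun hi hα]
    refine le_of_eq_of_le (Finset.prod_congr rfl fun j _ => ?_)
      (hX.prod_integral_le hα Finset.univ)
    rw [hY.integral_norm_rpow (hα j), hX.integral_norm_rpow (hα j), hvar]
  · obtain ⟨Y, h1, h2, h3⟩ := exists_independent_complexGaussian
      (fun j => ∫ ω, ‖X ω j‖ ^ 2 ∂P) fun j => integral_nonneg fun ω => by positivity
    exact ⟨_, _, stdComplexGaussian N, inferInstance, Y, h1, h2, h3⟩
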